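/- A parameterized problem over a finite alphabet $\Sigma$ is a set $L\subseteq\Sigma^*\times\mathbb N$. For parameterized problems $L_1\subseteq\Sigma_1^*\times\mathbb N$ and $L_2\subseteq\Sigma_2^*\times\mathbb N$, an fpt-reduction from $L_1$ to $L_2$ is a map $r:\Sigma_1^*\times\mathbb N\to\Sigma_2^*\times\mathbb N$ of the form $r(u,k)=(g(u,k),h(k))$ such that (i) $r(u,k)$ is computed by a deterministic Turing machine in at most $p(|u|)\cdot f(k)$ steps for some polynomial $p$ and some computable function $f:\mathbb N\to\mathbb N$, and (ii) $(u,k)\in L_1$ if and only if $r(u,k)\in L_2$, for all $u\in\Sigma_1^*$ and $k\in\mathbb N$. Write $L_1\equiv^{\mathsf{fpt}}L_2$ if there are fpt-reductions from $L_1$ to $L_2$ and from $L_2$ to $L_1$. Let $S_n$ be the symmetric group on $\{1,\dots,n\}$. The following three parameterized problems have as input an integer $n\ge 1$ (in unary), permutations $a,a_1,\dots,a_m\in S_n$ (each written as the list of its values at $1,\dots,n$, in binary), where $m\ge 0$, and the parameter $k\in\mathbb N$; products are evaluated from left to right. - $\mathsf{pF}[\mathsf S_*]$ (factorization): is $a\in\{a_1,\dots,a_m\}^k$,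 i.e. is $a$ a product of exactly $k$ factors from $\{a_1,\dots,a_m\}$, in any order and with repetitions allowed? - $\mathsf{pKS}[\mathsf S_*]$ (knapsack): are there $x_1,\dots,x_m\in\mathbb N$ with $\sum_{i=1}^m x_i=k$ and $a=a_1^{x_1}\cdots a_m^{x_m}$? - $\mathsf{pSSS}[\mathsf S_*]$ (subset sum): are there $x_1,\dots,x_m\in\{0,1\}$ with $\sum_{i=1}^m x_i=k$ and $a=a_1^{x_1}\cdots a_m^{x_m}$? Then these three problems are pairwise equivalent under fpt-reductions: $$\mathsf{pF}[\mathsf S_*]\equiv^{\mathsf{fpt}}\mathsf{pKS}[\mathsf S_*]\equiv^{\mathsf{fpt}}\mathsf{pSSS}[\mathsf S_*].$$ -/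

import Mathlib

/-- A parameterized problem over the alphabet `A`: a set of pairs of a word and a parameter. -/
abbrev ParamProblem (A : Type) : Type := Set (List A × ℕ)

/-- A pair `(u, k)` of a word and a parameter, written as a single word on the input or output
stack of a machine: the letters of `u`, followed by `k` in unary (`k` copies of the fresh
letter `none`). -/
def pairWord {A : Type} (x : List A × ℕ) : List (Option A) :=
  x.1.map some ++ List.replicate x.2 none

/-- `r` is computed by a Turing machine (Mathlib's multi-stack model `Turing.FinTM2`, whose
elementary steps are counted by `Turing.TM2OutputsInTime`) that on input `(u, k)` halts with
output `r (u, k)` after at most `p(|u|) * f(k)` steps, where `p` is a polynomial and `f` is a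
computable function. -/
def ComputableInFptTime {A B : Type} [Finite A] [Finite B]
    (r : List A × ℕ → List B × ℕ) : Prop :=
  ∃ (M : Turing.TM2ComputableAux (Option A) (Option B)) (p : Polynomial ℕ) (f : ℕ → ℕ),
    Computable f ∧ ∀ (u : List A) (k : ℕ),
      Nonempty (Turing.TM2OutputsInTime M.tm
        ((pairWord (u, k)).map M.inputAlphabet.symm)
        (some ((pairWord (r (u, k))).map M.outputAlphabet.symm))
        (p.eval u.length * f k))

/-- There is an fpt-reduction from `L₁` to `L₂`: a map `r (u, k) = (g (u, k), h k)`, computable in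
time `poly(|u|) * f(k)` for some computable `f`, such that `(u, k) ∈ L₁` iff `r (u, k) ∈ L₂`. -/
def FptReducible {A B : Type} [Finite A] [Finite B]
    (L₁ : ParamProblem A) (L₂ : ParamProblem B) : Prop :=
  ∃ r : List A × ℕ → List B × ℕ,
    (∃ (g : List A → ℕ → List B) (h : ℕ → ℕ), ∀ u k, r (u, k) = (g u k, h k)) ∧
    ComputableInFptTime r ∧
    ∀ u k, (u, k) ∈ L₁ ↔ r (u, k) ∈ L₂

/-- Equivalence under fpt-reductions. -/
def FptEquivalent {A B : Type} [Finite A] [Finite B]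
    (L₁ : ParamProblem A) (L₂ : ParamProblem B) : Prop :=
  FptReducible L₁ L₂ ∧ FptReducible L₂ L₁

open scoped Pointwise in
/-- Factorization: `a ∈ {a₁, …, aₘ}ᵏ`, i.e. `a` is a product of exactly `k` factors from the
list `as`, in any order and with repetitions allowed. -/
def IsFactorization {M : Type} [Monoid M] (a : M) (as : List M) (k : ℕ) : Prop :=
  a ∈ ({b | b ∈ as} : Set M) ^ k

/-- Knapsack: `a = a₁ ^ x₁ ⋯ aₘ ^ xₘ` for some natural numbers `xᵢ` with sum `k`. -/
def IsKnapsack {M : Type} [Monoid M] (a : M) (as : List M) (k : ℕ) : Prop :=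
  ∃ x : Fin as.length → ℕ, ∑ i, x i = k ∧ a = (List.ofFn fun i => as.get i ^ x i).prod

/-- Subset sum: `a = a₁ ^ x₁ ⋯ aₘ ^ xₘ` for some `xᵢ ∈ {0, 1}` with sum `k`. -/
def IsSubsetSum {M : Type} [Monoid M] (a : M) (as : List M) (k : ℕ) : Prop :=
  ∃ x : Fin as.length → ℕ, (∀ i, x i = 0 ∨ x i = 1) ∧ ∑ i, x i = k ∧
    a = (List.ofFn fun i => as.get i ^ x i).prod

/-- The symmetric group on `n` points. Products are evaluated from left to right (first the left
factor is applied), hence the opposite of Mathlib's `Equiv.Perm (Fin n)`. -/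
abbrev SymGroup (n : ℕ) : Type := (Equiv.Perm (Fin n))ᵐᵒᵖ

/-- The alphabet in which instances are written. -/
inductive Letter
  | zero
  | one
  | comma
  | semicolon
  deriving DecidableEq

instance : Fintype Letter where
  elems := {Letter.zero, Letter.one, Letter.comma, Letter.semicolon}
  complete := by intro x; cases x <;> decide

/-- The binary representation of a natural number, least significant bit first. -/
def binaryWord (x : ℕ) : List Letter :=
  x.bits.map fun b => bif b then Letter.one else Letter.zero

/-- A permutation `π` is written as the list `π(1), …, π(n)` of binary numbers; point number `i`
of `{1, …, n}` is the element `i - 1` of `Fin n`. -/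
def permWord {n : ℕ} (π : SymGroup n) : List Letter :=
  ((List.finRange n).flatMap fun i => binaryWord ((π.unop i : ℕ) + 1) ++ [Letter.comma]) ++
    [Letter.semicolon]

/-- The word for an instance `n, a, a₁, …, aₘ` over the symmetric group on `n` points; `n` is
written in unary. -/
def instanceWord (n : ℕ) (a : SymGroup n) (as : List (SymGroup n)) : List Letter :=
  List.replicate n Letter.one ++ [Letter.semicolon] ++ permWord a ++ as.flatMap permWord

/-- The parameterized problem over the class of all symmetric groups of degree `n ≥ 1` that asks
whether the given elements `a, a₁, …, aₘ` and the parameter `k` have the property `Q`. -/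
def symmetricGroupProblem
    (Q : ∀ {M : Type} [Monoid M], M → List M → ℕ → Prop) : ParamProblem Letter :=
  {x | ∃ (n : ℕ) (a : SymGroup n) (as : List (SymGroup n)),
    1 ≤ n ∧ x.1 = instanceWord n a as ∧ Q a as x.2}

/-- Parameterized factorization over symmetric groups. -/
def pFSym : ParamProblem Letter := symmetricGroupProblem IsFactorization

/-- Parameterized knapsack over symmetric groups. -/
def pKSSym : ParamProblem Letter := symmetricGroupProblem IsKnapsack

/-- Parameterized subset sum over symmetric groups. -/
def pSSSSym : ParamProblem Letter := symmetricGroupProblem IsSubsetSum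

/-! Each of the three problems asks whether `a` is a product of exactly `k` listed factors whose
indices satisfy a condition on neighbours: none for factorization, weakly increasing for knapsack,
strictly increasing for subset sum. All three conditions have the form `g (i + 1) ≤ j + 1`, where
`g` is `0`, the identity or the successor. For a fixed instance a subset sum solution is a knapsack
solution, and a knapsack solution is a factorization. So one construction serves all reductions,
provided that a chain product yields a subset sum solution of the new instance and any factorization
of the new target yields a chain product (`fptReducible_of_isChainProduct`).

The construction adds auxiliary points `Nat.pair r c`, seen as row `r`, column `c`. There is one new
factor for every time `t`, index `j` and number `i` with `g i ≤ j + 1`. It acts as the `j`-th old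
factor on the old points. On the auxiliary points it moves a token in column 0 from row `t` to row
`t + 1`, swaps columns 1 and `i + 1` of row `t` (checking), and swaps columns 1 and `j + 2` of row
`t + 1` (writing). An index `j` is recorded as `j + 1`; the number 0 is expected by the first step
and written by the last one, so that nothing remains. The new target acts as `a` on the old points
and as a cycle on the token column.

A token that has to climb `k` rows in `k` factors, each lifting it by at most one row, forces the
times `0, …, k - 1` in this order (`map_fst_eq_range'`). A row is restored only if the number
checked there is the number written before (`linked_of_auxAct`). Hence the indices used form a chain
(`exists_chain_of_prod`). Conversely, linked steps cancel row by row (`prod_stepPerm`). Since the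
factors are listed by increasing time, those of a chain form a sublist, even if an index repeats
(`exists_sublist_of_chain`).

Inputs that are not instances must be mapped to non-instances. The map does not test for
permutations: appending the values of a permutation of the auxiliary points gives the word of a
permutation only if the original field was one (`exists_perm_of_append_extWord`).

For the running time, small stack programs are compiled to machines (`exists_machine`), and the
words writable in time polynomial in `|u| + k` are shown to be closed under enough operations
(`Emits`) to contain the output (`emits_outWord`). Such a bound is at most a polynomial in `|u|`
times a computable function of `k`. -/

/-! ### Stack programs and their compilation into machines -/

/-- Structured programs over stacks indexed by `K` with letters from `Γ`. -/
inductive StackProg (K Γ : Type) : Type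
  | skip : StackProg K Γ
  | push (k : K) (a : Γ) : StackProg K Γ
  | pop (k : K) (f : Option Γ → StackProg K Γ) : StackProg K Γ
  | seq (p q : StackProg K Γ) : StackProg K Γ
  | loop (k : K) (f : Γ → StackProg K Γ) : StackProg K Γ

namespace StackProg

variable {K Γ : Type}

/-- `Runs p s s' n`: the program `p` started on the stacks `s` ends with the stacks `s'`
after exactly `n` steps. The loop `loop k f` pops letters `a` from the stack `k` and runs `f a`,
until the stack is empty. -/
inductive Runs [DecidableEq K] : StackProg K Γ → (K → List Γ) → (K → List Γ) → ℕ → Prop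
  | skip (s) : Runs skip s s 1
  | push (k a s) : Runs (push k a) s (Function.update s k (a :: s k)) 1
  | pop {k f s s' n} (h : Runs (f (s k).head?) (Function.update s k (s k).tail) s' n) :
      Runs (pop k f) s s' (n + 1)
  | seq {p q s s' s'' n n'} (h : Runs p s s' n) (h' : Runs q s' s'' n') :
      Runs (seq p q) s s'' (n + n')
  | loop_nil {k f s} (h : s k = []) : Runs (loop k f) s s 1
  | loop_cons {k f s s' s'' a l n n'} (h : s k = a :: l)
      (h₁ : Runs (f a) (Function.update s k l) s' n) (h₂ : Runs (loop k f) s' s'' n') :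
      Runs (loop k f) s s'' (n + 1 + n')

/-- The labels of the machine code of a program. -/
def Label : StackProg K Γ → Type
  | skip => Unit
  | push _ _ => Unit
  | pop _ f => Option (Σ x, Label (f x))
  | seq p q => Label p ⊕ Label q
  | loop _ f => Option (Σ x, Label (f x))

theorem finite_label [Finite Γ] : ∀ p : StackProg K Γ, Finite (Label p)
  | skip => inferInstanceAs (Finite Unit)
  | push _ _ => inferInstanceAs (Finite Unit)
  | pop _ f =>
    have : ∀ x, Finite (Label (f x)) := fun x => finite_label (f x)
    inferInstanceAs (Finite (Option (Σ x, Label (f x))))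
  | seq p q =>
    have := finite_label p
    have := finite_label q
    inferInstanceAs (Finite (Label p ⊕ Label q))
  | loop _ f =>
    have : ∀ x, Finite (Label (f x)) := fun x => finite_label (f x)
    inferInstanceAs (Finite (Option (Σ x, Label (f x))))

/-- The first label of the machine code of a program. -/
def entry : (p : StackProg K Γ) → Label p
  | skip => ()
  | push _ _ => ()
  | pop _ _ => none
  | seq p _ => Sum.inl (entry p)
  | loop _ _ => none

/-- The machine code of a program, as a part of a machine with labels `L` that goes on at the label
`exit`. -/
def code {L K' : Type} (ρ : K → K') : (p : StackProg K Γ) → (Label p → L) → L → Label p →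
    Turing.TM2.Stmt (fun _ : K' => Γ) L (Option Γ)
  | skip, _, exit, _ => .goto fun _ => exit
  | push k a, _, exit, _ => .push (ρ k) (fun _ => a) (.goto fun _ => exit)
  | pop k f, emb, exit, l =>
    match l with
    | none => .pop (ρ k) (fun _ x => x) (.goto fun v => emb (some ⟨v, entry (f v)⟩))
    | some ⟨x, l⟩ => code ρ (f x) (fun l => emb (some ⟨x, l⟩)) exit l
  | seq p q, emb, exit, l =>
    match l with
    | .inl l => code ρ p (fun l => emb (.inl l)) (emb (.inr (entry q))) l
    | .inr l => code ρ q (fun l => emb (.inr l)) exit l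
  | loop k f, emb, exit, l =>
    match l with
    | none => .pop (ρ k) (fun _ x => x) (.goto fun v =>
        match v with
        | none => exit
        | some x => emb (some ⟨x, entry (f x)⟩))
    | some ⟨x, l⟩ => code ρ (f x) (fun l => emb (some ⟨x, l⟩)) (emb none) l

/-- All stacks that occur in the program belong to `S`. -/
def Within (S : Set K) : StackProg K Γ → Prop
  | skip => True
  | push k _ => k ∈ S
  | pop k f => k ∈ S ∧ ∀ x, Within S (f x)
  | seq p q => Within S p ∧ Within S q
  | loop k f => k ∈ S ∧ ∀ x, Within S (f x)

theorem Within.mono {S T : Set K} (h : S ⊆ T) : ∀ {p : StackProg K Γ}, Within S p → Within T p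
  | skip, _ => trivial
  | push _ _, hp => h hp
  | pop _ _, hp => ⟨h hp.1, fun x => (hp.2 x).mono h⟩
  | seq _ _, hp => ⟨hp.1.mono h, hp.2.mono h⟩
  | loop _ _, hp => ⟨h hp.1, fun x => (hp.2 x).mono h⟩

/-- A machine has finitely many stacks, while the index type used later is infinite. A program over
a finite alphabet is a finitely branching, well-founded tree, so only finitely many stacks occur in
it, and the machine can be restricted to those. -/
theorem exists_within [Finite Γ] : ∀ p : StackProg K Γ, ∃ S : Set K, S.Finite ∧ Within S p
  | skip => ⟨∅, Set.finite_empty, trivial⟩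
  | push k _ => ⟨{k}, Set.finite_singleton k, rfl⟩
  | pop k f => by
    choose S hS hf using fun x => exists_within (f x)
    exact ⟨insert k (⋃ x, S x), (Set.finite_iUnion hS).insert k, Set.mem_insert _ _, fun x =>
      (hf x).mono ((Set.subset_iUnion S x).trans (Set.subset_insert _ _))⟩
  | seq p q => by
    obtain ⟨S, hS, hp⟩ := exists_within p
    obtain ⟨T, hT, hq⟩ := exists_within q
    exact ⟨S ∪ T, hS.union hT, hp.mono Set.subset_union_left, hq.mono Set.subset_union_right⟩
  | loop k f => by
    choose S hS hf using fun x => exists_within (f x)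
    exact ⟨insert k (⋃ x, S x), (Set.finite_iUnion hS).insert k, Set.mem_insert _ _, fun x =>
      (hf x).mono ((Set.subset_iUnion S x).trans (Set.subset_insert _ _))⟩

/-- `n` steps of a machine lead from one configuration to another. -/
def Steps {K' L σ : Type} [DecidableEq K'] {G : K' → Type} (m : L → Turing.TM2.Stmt G L σ) (n : ℕ)
    (c c' : Turing.TM2.Cfg G L σ) : Prop :=
  (flip bind (Turing.TM2.step m))^[n] (some c) = some c'

theorem Steps.trans {K' L σ : Type} [DecidableEq K'] {G : K' → Type}
    {m : L → Turing.TM2.Stmt G L σ} {n n' : ℕ} {c c' c'' : Turing.TM2.Cfg G L σ}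
    (h : Steps m n c c') (h' : Steps m n' c' c'') : Steps m (n + n') c c'' := by
  rw [Steps] at *
  rw [add_comm, Function.iterate_add_apply, h, h']

theorem Steps.single {K' L σ : Type} [DecidableEq K'] {G : K' → Type}
    {m : L → Turing.TM2.Stmt G L σ} {c c' : Turing.TM2.Cfg G L σ}
    (h : Turing.TM2.step m c = some c') : Steps m 1 c c' := h

theorem restrict_update [DecidableEq K] {S : Set K} [DecidableEq S] (s : K → List Γ) {k : K}
    (hk : k ∈ S) (w : List Γ) :
    (fun i : S => Function.update s k w i) = Function.update (fun i : S => s i) ⟨k, hk⟩ w := by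
  funext i
  by_cases h : i = ⟨k, hk⟩
  · subst h; simp
  · rw [Function.update_of_ne h, Function.update_of_ne fun h' => h (Subtype.ext h')]

/-- The machine code simulates the program. -/
theorem Runs.simulate [DecidableEq K] {S : Set K} [DecidableEq S] {L : Type} {ρ : K → S}
    (hρ : ∀ k (h : k ∈ S), ρ k = ⟨k, h⟩)
    (m : L → Turing.TM2.Stmt (fun _ : S => Γ) L (Option Γ))
    {p : StackProg K Γ} {s s' : K → List Γ} {n : ℕ} (h : Runs p s s' n) :
    ∀ (emb : Label p → L) (exit : L) (_ : Within S p) (_ : ∀ l, m (emb l) = code ρ p emb exit l)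
      (v : Option Γ), ∃ v', Steps m n ⟨some (emb (entry p)), v, fun i => s i⟩
        ⟨some exit, v', fun i => s' i⟩ := by
  induction h with
  | skip s =>
    intro emb exit hS hm v
    exact ⟨v, Steps.single (by simp [hm, code])⟩
  | push k a s =>
    intro emb exit hS hm v
    refine ⟨v, Steps.single ?_⟩
    rw [restrict_update s hS]
    simp [hm, code, hρ k hS]
  | @pop k f s s' n h ih =>
    intro emb exit hS hm v
    obtain ⟨v', hv'⟩ := ih (fun l => emb (some ⟨_, l⟩)) exit (hS.2 _) (fun l => hm _) (s k).head?
    refine ⟨v', ?_⟩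
    rw [add_comm]
    refine Steps.trans (Steps.single ?_) hv'
    rw [restrict_update s hS.1, Turing.TM2.step, hm]
    simp [code, hρ k hS.1, entry]
  | seq h h' ih ih' =>
    intro emb exit hS hm v
    obtain ⟨v', hv'⟩ := ih (fun l => emb (.inl l)) _ hS.1 (fun l => hm _) v
    obtain ⟨v'', hv''⟩ := ih' (fun l => emb (.inr l)) exit hS.2 (fun l => hm _) v'
    exact ⟨v'', hv'.trans hv''⟩
  | @loop_nil k f s h =>
    intro emb exit hS hm v
    refine ⟨none, Steps.single ?_⟩
    have : Function.update (fun i : S => s i) ⟨k, hS.1⟩ [] = fun i : S => s i := by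
      rw [Function.update_eq_self_iff]; exact h.symm
    rw [Turing.TM2.step, hm]
    simp [code, hρ k hS.1, entry, h, this]
  | @loop_cons k f s s' s'' a l n n' h h₁ h₂ ih₁ ih₂ =>
    intro emb exit hS hm v
    obtain ⟨v', hv'⟩ := ih₁ (fun l => emb (some ⟨_, l⟩)) (emb none) (hS.2 _) (fun l => hm _)
        (some a)
    obtain ⟨v'', hv''⟩ := ih₂ emb exit hS hm v'
    refine ⟨v'', Steps.trans ?_ hv''⟩
    rw [add_comm]
    refine Steps.trans (Steps.single ?_) hv'
    rw [restrict_update s hS.1, Turing.TM2.step, hm]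
    simp [code, hρ k hS.1, entry, h]

/-- `p` leads from `s` to `s'` in at most `t` steps. -/
def RunsIn [DecidableEq K] (p : StackProg K Γ) (s s' : K → List Γ) (t : ℕ) : Prop :=
  ∃ n ≤ t, Runs p s s' n

/-- A program that turns the input word on stack `k` into the output word on the same stack, all
other stacks being empty, gives a machine. -/
theorem exists_machine [DecidableEq K] [Finite Γ] (p : StackProg K Γ) (k : K) :
    ∃ M : Turing.TM2ComputableAux Γ Γ, ∀ (x y : List Γ) (t : ℕ),
      RunsIn p (Function.update (fun _ => []) k x) (Function.update (fun _ => []) k y) t →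
      Nonempty (Turing.TM2OutputsInTime M.tm (x.map M.inputAlphabet.symm)
        (some (y.map M.outputAlphabet.symm)) (t + 1)) := by
  classical
  obtain ⟨S₀, hS₀, hp₀⟩ := exists_within p
  let S : Set K := insert k S₀
  have hp : Within S p := hp₀.mono (Set.subset_insert _ _)
  have hk : k ∈ S := Set.mem_insert _ _
  have : Finite S := (hS₀.insert k).to_subtype
  have := finite_label p
  let ρ : K → S := fun i => if h : i ∈ S then ⟨i, h⟩ else ⟨k, hk⟩
  have hρ : ∀ i (h : i ∈ S), ρ i = ⟨i, h⟩ := fun i h => dif_pos h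
  -- A halting configuration must carry the initial internal state. The extra label `none` resets
  -- the state and halts, which accounts for the additional step in the bound `t + 1`.
  let m : Option (Label p) → Turing.TM2.Stmt (fun _ : S => Γ) (Option (Label p)) (Option Γ) :=
    fun l => match l with
      | none => .load (fun _ => none) .halt
      | some l => code ρ p some none l
  let tm : Turing.FinTM2 :=
    { K := S
      kDecidableEq := inferInstance
      kFin := Fintype.ofFinite _
      k₀ := ⟨k, hk⟩
      k₁ := ⟨k, hk⟩
      Γ := fun _ => Γ
      Λ := Option (Label p)
      main := some (entry p)
      ΛFin := Fintype.ofFinite _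
      σ := Option Γ
      initialState := none
      σFin := Fintype.ofFinite _
      Γk₀Fin := Fintype.ofFinite _
      m := m }
  refine ⟨⟨tm, Equiv.refl Γ, Equiv.refl Γ⟩, fun x y t ⟨n, hn, h⟩ => ?_⟩
  obtain ⟨v, hv⟩ := h.simulate hρ m some none hp (fun l => rfl) none
  have hstep : Steps m 1 ⟨some none, v, fun i : S => Function.update (fun _ => []) k y (i : K)⟩
      ⟨none, none, fun i : S => Function.update (fun _ => []) k y (i : K)⟩ :=
    Steps.single (by simp [m])
  have h2 := hv.trans hstep
  have hinit : Turing.initList tm x =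
      ⟨some (some (entry p)), none, fun i : S => Function.update (fun _ => []) k x (i : K)⟩ := by
    refine congrArg (Turing.TM2.Cfg.mk _ _) (funext fun i => ?_)
    by_cases hi : i = ⟨k, hk⟩
    · subst hi; simp [tm]
    · rw [dif_neg hi, Function.update_of_ne fun h' => hi (Subtype.ext h')]
  have hhalt : Turing.haltList tm y =
      ⟨none, none, fun i : S => Function.update (fun _ => []) k y (i : K)⟩ := by
    refine congrArg (Turing.TM2.Cfg.mk _ _) (funext fun i => ?_)
    by_cases hi : i = ⟨k, hk⟩
    · subst hi; simp [tm]
    · rw [dif_neg hi, Function.update_of_ne fun h' => hi (Subtype.ext h')]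
  have hmap : ∀ z : List Γ, z.map (Equiv.refl Γ).symm = z := fun z => by simp
  refine ⟨⟨⟨n + 1, ?_⟩, Nat.succ_le_succ hn⟩⟩
  rw [← hinit, ← hhalt] at h2
  have key : (flip bind tm.step)^[n + 1] (some (Turing.initList tm x)) =
    some (Turing.haltList tm y) := h2
  rw [← hmap x, ← hmap y] at key
  exact key

end StackProg

/-! ### Running times of elementary loops -/

namespace StackProg

section RunsIn

variable {K Γ : Type} [DecidableEq K]

theorem RunsIn.mono {p : StackProg K Γ} {s s' : K → List Γ} {t t' : ℕ} (h : RunsIn p s s' t)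
    (ht : t ≤ t') : RunsIn p s s' t' := by
  obtain ⟨n, hn, h⟩ := h
  exact ⟨n, hn.trans ht, h⟩

theorem RunsIn.congr {p : StackProg K Γ} {s s' s₁ : K → List Γ} {t t' : ℕ} (h : RunsIn p s s' t)
    (hs : s' = s₁) (ht : t ≤ t') : RunsIn p s s₁ t' := hs ▸ h.mono ht

theorem RunsIn.skip (s : K → List Γ) : RunsIn skip s s 1 := ⟨1, le_rfl, .skip s⟩

theorem RunsIn.push (k : K) (a : Γ) (s : K → List Γ) :
    RunsIn (push k a) s (Function.update s k (a :: s k)) 1 := ⟨1, le_rfl, .push k a s⟩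

theorem RunsIn.pop {k : K} {f : Option Γ → StackProg K Γ} {s s' : K → List Γ} {t : ℕ}
    (h : RunsIn (f (s k).head?) (Function.update s k (s k).tail) s' t) :
    RunsIn (pop k f) s s' (t + 1) := by
  obtain ⟨n, hn, h⟩ := h
  exact ⟨n + 1, Nat.succ_le_succ hn, .pop h⟩

theorem RunsIn.seq {p q : StackProg K Γ} {s s' s'' : K → List Γ} {t t' : ℕ}
    (h : RunsIn p s s' t) (h' : RunsIn q s' s'' t') : RunsIn (seq p q) s s'' (t + t') := by
  obtain ⟨n, hn, h⟩ := h
  obtain ⟨n', hn', h'⟩ := h'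
  exact ⟨n + n', Nat.add_le_add hn hn', .seq h h'⟩

theorem RunsIn.loop_nil {k : K} {f : Γ → StackProg K Γ} {s : K → List Γ} (h : s k = []) :
    RunsIn (loop k f) s s 1 := ⟨1, le_rfl, .loop_nil h⟩

theorem RunsIn.loop_cons {k : K} {f : Γ → StackProg K Γ} {s s' s'' : K → List Γ} {a : Γ}
    {l : List Γ} {t t' : ℕ} (h : s k = a :: l)
    (h₁ : RunsIn (f a) (Function.update s k l) s' t) (h₂ : RunsIn (loop k f) s' s'' t') :
    RunsIn (loop k f) s s'' (t + 1 + t') := by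
  obtain ⟨n, hn, h₁⟩ := h₁
  obtain ⟨n', hn', h₂⟩ := h₂
  exact ⟨n + 1 + n', by omega, .loop_cons h h₁ h₂⟩

/-- A loop whose body does not touch the stack that controls it. -/
theorem RunsIn.loop_of_forall {k : K} {f : Γ → StackProg K Γ} {t : ℕ} :
    ∀ (w : List Γ) (S : ℕ → K → List Γ) (_ : ∀ j, S j k = w.drop j)
      (_ : ∀ j (hj : j < w.length),
        RunsIn (f w[j]) (Function.update (S j) k (w.drop (j + 1))) (S (j + 1)) t),
      RunsIn (loop k f) (S 0) (S w.length) (w.length * (t + 1) + 1)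
  | [], S, h, _ => (RunsIn.loop_nil (by simpa using h 0)).mono (by simp)
  | a :: w, S, h, hf => by
    refine (RunsIn.loop_cons (s' := S 1) (a := a) (l := w) (by simpa using h 0)
      (hf 0 (by simp))
      (RunsIn.loop_of_forall w (fun j => S (j + 1)) (fun j => by simpa using h (j + 1))
        fun j hj => hf (j + 1) (by simpa using hj))).mono ?_
    simp only [List.length_cons]
    linarith

theorem RunsIn.clear (k : K) (s : K → List Γ) :
    RunsIn (StackProg.loop k fun _ => StackProg.skip) s (Function.update s k [])
      (2 * (s k).length + 1) := by
  have h := RunsIn.loop_of_forall (t := 1) (k := k) (f := fun _ => StackProg.skip) (s k)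
    (fun j => Function.update s k ((s k).drop j)) (fun j => by simp)
    fun j hj => (RunsIn.skip _).congr (by simp) le_rfl
  exact RunsIn.congr (t := (s k).length * (1 + 1) + 1) (by simpa using h) rfl (by omega)

theorem reverse_map_take_succ {j : ℕ} {w : List Γ} (hj : j < w.length) (g : Γ → Γ) :
    ((w.take (j + 1)).map g).reverse = g w[j] :: ((w.take j).map g).reverse := by
  rw [List.take_add_one, List.getElem?_eq_getElem hj, List.map_append, List.reverse_append]
  rfl

/-- Moving a stack letter by letter onto another one. -/
theorem RunsIn.transfer {k k' : K} (hk : k' ≠ k) (g : Γ → Γ) (s : K → List Γ) :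
    RunsIn (StackProg.loop k fun x => StackProg.push k' (g x)) s
      (Function.update (Function.update s k []) k' (((s k).map g).reverse ++ s k'))
      (2 * (s k).length + 1) := by
  have h := RunsIn.loop_of_forall (t := 1) (k := k) (f := fun x => StackProg.push k' (g x)) (s k)
    (fun j => Function.update (Function.update s k ((s k).drop j)) k'
      ((((s k).take j).map g).reverse ++ s k')) (fun j => by simp [hk.symm]) fun j hj => by
        refine (RunsIn.push _ _ _).congr ?_ le_rfl
        funext i
        by_cases hi : i = k'
        · subst hi; simp [-List.map_take, hk, reverse_map_take_succ hj]
        · by_cases hi' : i = k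
          · subst hi'; simp [hi]
          · simp [hi, hi']
  refine RunsIn.congr (t := (s k).length * (1 + 1) + 1) (by simpa using h) rfl (by omega)

/-- Moving a stack letter by letter onto two others. -/
theorem RunsIn.transfer₂ {k k' k'' : K} (hk : k' ≠ k) (hk' : k'' ≠ k) (hk'' : k'' ≠ k')
    (g g' : Γ → Γ) (s : K → List Γ) :
    RunsIn (StackProg.loop k fun x => (StackProg.push k' (g x)).seq (StackProg.push k'' (g' x))) s
      (Function.update (Function.update (Function.update s k []) k'
        (((s k).map g).reverse ++ s k')) k'' (((s k).map g').reverse ++ s k''))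
      (3 * (s k).length + 1) := by
  have h := RunsIn.loop_of_forall (t := 2) (k := k)
    (f := fun x => (StackProg.push k' (g x)).seq (StackProg.push k'' (g' x))) (s k)
    (fun j => Function.update (Function.update (Function.update s k ((s k).drop j)) k'
      ((((s k).take j).map g).reverse ++ s k')) k'' ((((s k).take j).map g').reverse ++ s k''))
    (fun j => by simp [hk.symm, hk'.symm]) fun j hj => by
        refine ((RunsIn.push _ _ _).seq (RunsIn.push _ _ _)).congr ?_ le_rfl
        funext i
        by_cases hi : i = k''
        · subst hi; simp [-List.map_take, hk', hk'', reverse_map_take_succ hj]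
        · by_cases hi₁ : i = k'
          · subst hi₁; simp [-List.map_take, hi, hk, reverse_map_take_succ hj]
          · by_cases hi' : i = k
            · subst hi'; simp [hi, hi₁]
            · simp [hi, hi', hi₁]
  refine RunsIn.congr (t := (s k).length * (2 + 1) + 1) (by simpa using h) rfl (by omega)

end RunsIn

/-! ### Words that can be written in polynomial time -/

/-- The stacks of the machines below: the input word, variables in unary, loop counters, and a
sequence of stacks that results are written to. -/
inductive Stk
  | inp
  | var (i : ℕ)
  | cnt (i : ℕ)
  | tgt (i : ℕ)
  deriving DecidableEq

open Stk

/-- Programs over the alphabet of the input and output words. -/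
abbrev Prog : Type := StackProg Stk (Option Letter)

/-- A stack of unary digits. -/
abbrev marks (n : ℕ) : List (Option Letter) := List.replicate n none

/-- The stacks `s` hold the input word `u` and the variables `env`; the variables and loop counters
from `d` on and the targets after `e` are empty. -/
structure Rep (d e : ℕ) (u : List Letter) (env : ℕ → ℕ) (s : Stk → List (Option Letter)) :
    Prop where
  inp : s inp = u.map some
  var : ∀ i, s (var i) = marks (env i)
  cnt : ∀ i, d ≤ i → s (cnt i) = []
  tgt : ∀ i, e < i → s (tgt i) = []

/-- Variables are bounded by `B`, as is the length of the input word; variables from `d` on are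
`0`. -/
structure Bounded (d : ℕ) (u : List Letter) (env : ℕ → ℕ) (B : ℕ) : Prop where
  length_le : u.length ≤ B
  le : ∀ i, env i ≤ B
  eq_zero : ∀ i, d ≤ i → env i = 0

/-- The word `f u env` can be written in polynomial time, where `u` is the input word and `env` are
the values of variables, of which the first `d` are in use. -/
def Emits (d : ℕ) (f : List Letter → (ℕ → ℕ) → List (Option Letter)) : Prop :=
  ∃ (p : ℕ → Prog) (P : Polynomial ℕ), ∀ u env B, Bounded d u env B →
    (f u env).length ≤ P.eval B ∧ ∀ e s, Rep d e u env s →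
      RunsIn (p e) s (Function.update s (tgt e) ((f u env).reverse ++ s (tgt e))) (P.eval B)

/-- The number `f u env` can be computed in polynomial time, in unary. -/
def EmitsNat (d : ℕ) (f : List Letter → (ℕ → ℕ) → ℕ) : Prop :=
  Emits d fun u env => marks (f u env)

variable {d : ℕ}

theorem Rep.update_tgt {d e u env s} (h : Rep d e u env s) (e' : ℕ) (w) :
    Rep d (max e e') u env (Function.update s (Stk.tgt e') w) where
  inp := by simpa using h.inp
  var i := by simpa using h.var i
  cnt i hi := by simpa using h.cnt i hi
  tgt i hi := by
    rw [Function.update_of_ne (by simp; omega)]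
    exact h.tgt i (by omega)

theorem Rep.mono {d d' e e' u env s} (h : Rep d e u env s) (hd : d ≤ d') (he : e ≤ e') :
    Rep d' e' u env s :=
  ⟨h.inp, h.var, fun i hi => h.cnt i (hd.trans hi), fun i hi => h.tgt i (he.trans_lt hi)⟩

theorem Emits.nil : Emits d fun _ _ => [] :=
  ⟨fun _ => .skip, 1, fun u env B _ => ⟨by simp, fun e s _ => by simpa using RunsIn.skip s⟩⟩

theorem Emits.single (a : Option Letter) : Emits d fun _ _ => [a] :=
  ⟨fun e => .push (tgt e) a, 1, fun u env B _ =>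
    ⟨by simp, fun e s _ => by simpa using RunsIn.push (tgt e) a s⟩⟩

theorem Emits.append {f g : List Letter → (ℕ → ℕ) → List (Option Letter)} (hf : Emits d f)
    (hg : Emits d g) : Emits d fun u env => f u env ++ g u env := by
  obtain ⟨p, P, hp⟩ := hf
  obtain ⟨q, Q, hq⟩ := hg
  refine ⟨fun e => (p e).seq (q e), P + Q, fun u env B hB => ⟨?_, fun e s hs => ?_⟩⟩
  · simpa using Nat.add_le_add (hp u env B hB).1 (hq u env B hB).1
  · refine (((hp u env B hB).2 e s hs).seq ((hq u env B hB).2 e _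
      ((hs.update_tgt e _).mono le_rfl (by simp)))).congr (by simp) (by simp)

theorem EmitsNat.add {f g : List Letter → (ℕ → ℕ) → ℕ} (hf : EmitsNat d f) (hg : EmitsNat d g) :
    EmitsNat d fun u env => f u env + g u env := by
  have h := Emits.append hf hg
  simp only [marks, ← List.replicate_add] at h
  exact h

theorem EmitsNat.const : ∀ n : ℕ, EmitsNat d fun _ _ => n
  | 0 => Emits.nil
  | n + 1 => (EmitsNat.const n).add (Emits.single none)

/-- A target is filled by pushing, so its top letter is the last letter of the word; hence
`getLast?`. The scratch target is cleared before branching, so that each branch starts from the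
original stacks. -/
theorem Emits.branch {g : List Letter → (ℕ → ℕ) → List (Option Letter)}
    {f : Option (Option Letter) → List Letter → (ℕ → ℕ) → List (Option Letter)} (hg : Emits d g)
    (hf : ∀ x, Emits d (f x)) : Emits d fun u env => f (g u env).getLast? u env := by
  obtain ⟨q, Q, hq⟩ := hg
  choose p P hp using hf
  refine ⟨fun e => (q (e + 1)).seq (.pop (tgt (e + 1)) fun x =>
    (StackProg.loop (tgt (e + 1)) fun _ => .skip).seq (p x e)), 3 * Q + 3 + ∑ x, P x,
    fun u env B hB => ?_⟩
  have hle : ∀ x, (P x).eval B ≤ (∑ x, P x).eval B := fun x => by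
    rw [Polynomial.eval_finsetSum]
    exact Finset.single_le_sum (f := fun x => (P x).eval B) (fun _ _ => Nat.zero_le _)
      (Finset.mem_univ x)
  refine ⟨?_, fun e s hs => ?_⟩
  · refine ((hp _ u env B hB).1.trans (hle _)).trans ?_
    simp
  · have h0 : s (tgt (e + 1)) = [] := hs.tgt _ (by omega)
    have h1 := (hq u env B hB).2 (e + 1) s (hs.mono le_rfl (by omega))
    rw [h0, List.append_nil] at h1
    have h2 := RunsIn.clear (tgt (e + 1)) (Function.update (Function.update s (tgt (e + 1))
      (g u env).reverse) (tgt (e + 1)) (g u env).reverse.tail)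
    have h3 : Function.update (Function.update (Function.update s (tgt (e + 1))
      (g u env).reverse) (tgt (e + 1)) (g u env).reverse.tail) (tgt (e + 1)) [] = s := by
      simp [← h0]
    rw [h3] at h2
    have h4 := h2.seq ((hp (g u env).getLast? u env B hB).2 e s hs)
    refine (h1.seq (RunsIn.pop (t := 2 * Q.eval B + 1 + (∑ x, P x).eval B) ?_)).congr rfl ?_
    · simp only [Function.update_self, List.head?_reverse]
      refine h4.mono (Nat.add_le_add ?_ (hle _))
      have := (hq u env B hB).1
      simp
      omega
    · simp only [Polynomial.eval_add, Polynomial.eval_mul, Polynomial.eval_ofNat]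
      omega

theorem Emits.ite_eq_zero {g : List Letter → (ℕ → ℕ) → ℕ}
    {f f' : List Letter → (ℕ → ℕ) → List (Option Letter)} (hg : EmitsNat d g)
    (hf : Emits d f) (hf' : Emits d f') :
    Emits d fun u env => if g u env = 0 then f u env else f' u env := by
  have h := Emits.branch (f := fun x => if x = none then f else f') hg
    fun x => by split_ifs <;> assumption
  convert h using 4 with u env
  cases g u env <;> simp [List.getLast?_replicate]

/-- Popping an empty stack does nothing, which is exactly the truncation at zero. -/
theorem EmitsNat.sub {f g : List Letter → (ℕ → ℕ) → ℕ} (hf : EmitsNat d f) (hg : EmitsNat d g) :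
    EmitsNat d fun u env => f u env - g u env := by
  obtain ⟨p, P, hp⟩ := hf
  obtain ⟨q, Q, hq⟩ := hg
  refine ⟨fun e => (p (e + 1)).seq ((q (e + 2)).seq
    ((StackProg.loop (tgt (e + 2)) fun _ => .pop (tgt (e + 1)) fun _ => .skip).seq
      (StackProg.loop (tgt (e + 1)) fun _ => .push (tgt e) none))), 3 * P + 4 * Q + 2,
    fun u env B hB => ?_⟩
  have hP := (hp u env B hB).1
  have hQ := (hq u env B hB).1
  simp only [List.length_replicate] at hP hQ
  refine ⟨?_, fun e s hs => ?_⟩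
  · simp
    omega
  have h1 := (hp u env B hB).2 (e + 1) s (hs.mono le_rfl (by omega))
  have h2 := (hq u env B hB).2 (e + 2) _ ((hs.update_tgt (e + 1)
    ((marks (f u env)).reverse ++ s (tgt (e + 1)))).mono le_rfl (e' := e + 2) (by simp))
  have h0 : s (tgt (e + 1)) = [] := hs.tgt _ (by omega)
  have h0' : s (tgt (e + 2)) = [] := hs.tgt _ (by omega)
  simp only [h0, h0', List.append_nil, List.reverse_replicate, ne_eq, Stk.tgt.injEq,
    Function.update_of_ne, show ¬ e + 2 = e + 1 by omega, not_false_eq_true] at h1 h2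
  have h3 := RunsIn.loop_of_forall (t := 2) (k := tgt (e + 2))
    (f := fun _ => .pop (tgt (e + 1)) fun _ => .skip) (marks (g u env))
    (fun j => Function.update (Function.update s (tgt (e + 1)) (marks (f u env - j))) (tgt (e + 2))
      ((marks (g u env)).drop j)) (fun j => by simp) fun j hj => by
        refine (RunsIn.pop (RunsIn.skip _)).congr ?_ le_rfl
        funext i
        by_cases hi : i = tgt (e + 1)
        · subst hi; simp [Nat.sub_sub]
        · by_cases hi' : i = tgt (e + 2)
          · subst hi'; simp
          · simp [hi, hi']
  have h4 := RunsIn.transfer (k := tgt (e + 1)) (k' := tgt e) (by simp) (fun _ => none)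
    (Function.update (Function.update s (tgt (e + 1)) (marks (f u env - g u env)))
      (tgt (e + 2)) [])
  simp only [List.length_replicate, List.drop_replicate, Nat.sub_zero, Nat.sub_self,
    List.replicate_zero] at h3
  refine (h1.seq (h2.seq (h3.seq h4))).congr ?_ ?_
  · funext i
    by_cases hi : i = tgt e
    · subst hi; simp
    by_cases hi' : i = tgt (e + 1)
    · subst hi'; simp [h0]
    by_cases hi'' : i = tgt (e + 2)
    · subst hi''; simp [h0']
    simp [hi, hi', hi'']
  · simp
    omega

end StackProg

namespace StackProg

open Stk

variable {d : ℕ}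

theorem Bounded.mono {u env B B'} (h : Bounded d u env B) (hB : B ≤ B') : Bounded d u env B' :=
  ⟨h.length_le.trans hB, fun i => (h.le i).trans hB, h.eq_zero⟩

theorem Bounded.update {u env B n} (h : Bounded d u env B) (hn : n ≤ B) :
    Bounded (d + 1) u (Function.update env d n) B where
  length_le := h.length_le
  le i := by
    rw [Function.update_apply]
    split_ifs
    exacts [hn, h.le i]
  eq_zero i hi := by
    rw [Function.update_of_ne (by omega)]
    exact h.eq_zero i (by omega)

theorem Rep.set_var {e u env s} (h : Rep d e u env s) (n : ℕ) :
    Rep (d + 1) e u (Function.update env d n) (Function.update s (Stk.var d) (marks n)) where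
  inp := by simpa using h.inp
  var i := by
    by_cases hi : i = d
    · subst hi; simp
    · simpa [hi] using h.var i
  cnt i hi := by simpa using h.cnt i (by omega)
  tgt i hi := by simpa using h.tgt i hi

theorem Rep.update_cnt {e u env s i} (h : Rep (d + 1) e u env s) (hi : i < d + 1) (w) :
    Rep (d + 1) e u env (Function.update s (Stk.cnt i) w) where
  inp := by simpa using h.inp
  var j := by simpa using h.var j
  cnt j hj := by
    rw [Function.update_of_ne (by simp; omega)]
    exact h.cnt j hj
  tgt j hj := by simpa using h.tgt j hj

/-- This is a local definition: the value stays on the stack `var d` while the body runs and is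
cleared afterwards. The new variable is bounded only by `Q.eval B`, so the polynomial of the body is
composed with `X + Q`. -/
theorem Emits.bind {g : List Letter → (ℕ → ℕ) → ℕ}
    {f : List Letter → (ℕ → ℕ) → List (Option Letter)} (hg : EmitsNat d g) (hf : Emits (d + 1) f) :
    Emits d fun u env => f u (Function.update env d (g u env)) := by
  obtain ⟨q, Q, hq⟩ := hg
  obtain ⟨p, P, hp⟩ := hf
  refine ⟨fun e => (q (e + 1)).seq ((StackProg.loop (tgt (e + 1)) fun _ => .push (var d) none).seq
    ((p e).seq (.loop (var d) fun _ => .skip))), 5 * Q + 2 + P.comp (Polynomial.X + Q),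
    fun u env B hB => ?_⟩
  have hQ := (hq u env B hB).1
  simp only [List.length_replicate] at hQ
  have hB' : Bounded (d + 1) u (Function.update env d (g u env)) (B + Q.eval B) :=
    (hB.mono (Nat.le_add_right _ _)).update (hQ.trans (Nat.le_add_left _ _))
  refine ⟨?_, fun e s hs => ?_⟩
  · refine (hp _ _ _ hB').1.trans ?_
    simp
  have h0 : s (tgt (e + 1)) = [] := hs.tgt _ (by omega)
  have hv : s (var d) = [] := by rw [hs.var, hB.eq_zero d le_rfl]; rfl
  have h1 := (hq u env B hB).2 (e + 1) s (hs.mono le_rfl (by omega))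
  have h2 := RunsIn.transfer (k := tgt (e + 1)) (k' := var d) (by simp) (fun _ => none)
    (Function.update s (tgt (e + 1)) ((marks (g u env)).reverse ++ s (tgt (e + 1))))
  have e2 : Function.update (Function.update (Function.update s (tgt (e + 1))
      ((marks (g u env)).reverse ++ s (tgt (e + 1)))) (tgt (e + 1)) []) (var d)
      (((Function.update s (tgt (e + 1)) ((marks (g u env)).reverse ++ s (tgt (e + 1)))
        (tgt (e + 1))).map (fun _ => none)).reverse ++ (Function.update s (tgt (e + 1))
          ((marks (g u env)).reverse ++ s (tgt (e + 1)))) (var d)) =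
      Function.update s (var d) (marks (g u env)) := by
    rw [Function.update_idem, ← h0, Function.update_eq_self]
    simp [h0, hv]
  rw [e2] at h2
  have h3 := (hp _ _ _ hB').2 e _ (hs.set_var (g u env))
  have h4 := RunsIn.clear (var d) (Function.update (Function.update s (var d) (marks (g u env)))
    (tgt e) ((f u (Function.update env d (g u env))).reverse ++ s (tgt e)))
  refine (h1.seq (h2.seq (h3.seq h4))).congr ?_ ?_
  · funext i
    by_cases hi : i = tgt e
    · subst hi; simp
    by_cases hi' : i = var d
    · subst hi'; simp [hv]
    simp [hi, hi']
  · simp [h0]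
    omega

theorem length_flatMap_le {α β : Type} {f : α → List β} {c : ℕ} :
    ∀ {l : List α}, (∀ x ∈ l, (f x).length ≤ c) → (l.flatMap f).length ≤ l.length * c
  | [], _ => by simp
  | a :: l, h => by
    have h1 := length_flatMap_le fun x hx => h x (List.mem_cons_of_mem a hx)
    have h2 := h a List.mem_cons_self
    simp only [List.flatMap_cons, List.length_append, List.length_cons]
    linarith

/-- The stack `cnt d` counts the remaining rounds while `var d` counts up. The body lives at depth
`d + 1` and therefore does not need `cnt d` to be empty. -/
theorem Emits.forRange {g : List Letter → (ℕ → ℕ) → ℕ}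
    {f : List Letter → (ℕ → ℕ) → List (Option Letter)} (hg : EmitsNat d g) (hf : Emits (d + 1) f) :
    Emits d fun u env => (List.range (g u env)).flatMap fun x => f u (Function.update env d x) := by
  obtain ⟨q, Q, hq⟩ := hg
  obtain ⟨p, P, hp⟩ := hf
  refine ⟨fun e => (q (e + 1)).seq ((StackProg.loop (tgt (e + 1)) fun _ => .push (cnt d) none).seq
    ((StackProg.loop (cnt d) fun _ => (p e).seq (.push (var d) none)).seq
      (.loop (var d) fun _ => .skip))), 5 * Q + 3 + Q * (P.comp (Polynomial.X + Q) + 2),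
    fun u env B hB => ?_⟩
  have hQ := (hq u env B hB).1
  simp only [List.length_replicate] at hQ
  have hB' : ∀ x < g u env, Bounded (d + 1) u (Function.update env d x) (B + Q.eval B) :=
    fun x hx => (hB.mono (Nat.le_add_right _ _)).update ((hx.le.trans hQ).trans
      (Nat.le_add_left _ _))
  refine ⟨?_, fun e s hs => ?_⟩
  · refine (length_flatMap_le (c := (P.comp (Polynomial.X + Q) + 2).eval B) fun x hx => ?_).trans ?_
    · refine (hp _ _ _ (hB' x (List.mem_range.1 hx))).1.trans ?_
      simp
    · rw [List.length_range, Polynomial.eval_add (p := 5 * Q + 3), Polynomial.eval_mul]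
      exact (Nat.mul_le_mul_right _ hQ).trans (Nat.le_add_left _ _)
  have h0 : s (tgt (e + 1)) = [] := hs.tgt _ (by omega)
  have hv : s (var d) = [] := by rw [hs.var, hB.eq_zero d le_rfl]; rfl
  have hc : s (cnt d) = [] := hs.cnt d le_rfl
  have h1 := (hq u env B hB).2 (e + 1) s (hs.mono le_rfl (by omega))
  have h2 := RunsIn.transfer (k := tgt (e + 1)) (k' := cnt d) (by simp) (fun _ => none)
    (Function.update s (tgt (e + 1)) ((marks (g u env)).reverse ++ s (tgt (e + 1))))
  have e2 : Function.update (Function.update (Function.update s (tgt (e + 1))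
      ((marks (g u env)).reverse ++ s (tgt (e + 1)))) (tgt (e + 1)) []) (cnt d)
      (((Function.update s (tgt (e + 1)) ((marks (g u env)).reverse ++ s (tgt (e + 1)))
        (tgt (e + 1))).map (fun _ => none)).reverse ++ (Function.update s (tgt (e + 1))
          ((marks (g u env)).reverse ++ s (tgt (e + 1)))) (cnt d)) =
      Function.update s (cnt d) (marks (g u env)) := by
    rw [Function.update_idem, ← h0, Function.update_eq_self]
    simp [h0, hc]
  rw [e2] at h2
  -- The loop invariant: the stacks after `j` rounds.
  let S : ℕ → Stk → List (Option Letter) := fun j =>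
    Function.update (Function.update (Function.update s (var d) (marks j)) (cnt d)
      (marks (g u env - j))) (tgt e)
      (((List.range j).flatMap fun x => f u (Function.update env d x)).reverse ++ s (tgt e))
  have h3 := RunsIn.loop_of_forall (k := cnt d) (t := (P.comp (Polynomial.X + Q)).eval B + 1)
    (f := fun _ => (p e).seq (.push (var d) none)) (marks (g u env)) S (fun j => by simp [S])
    fun j hj => by
      simp only [List.length_replicate] at hj
      have h := (hp _ _ _ (hB' j hj)).2 e (Function.update (S j) (cnt d)
        ((marks (g u env)).drop (j + 1))) ((((hs.set_var j).update_cnt (by omega) _).update_tgt e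
          _).mono le_rfl (by simp) |>.update_cnt (by omega) _)
      refine (h.seq (RunsIn.push _ _ _)).congr ?_ (by simp)
      funext i
      by_cases hi : i = tgt e
      · subst hi; simp [S, List.range_succ]
      by_cases hi' : i = var d
      · subst hi'; simp [S, List.replicate_succ]
      by_cases hi'' : i = cnt d
      · subst hi''; simp [S]
      simp [hi, hi', hi'', S]
  have hS : S 0 = Function.update s (cnt d) (marks (g u env)) := by
    funext i
    by_cases hi : i = tgt e
    · subst hi; simp [S]
    by_cases hi' : i = var d
    · subst hi'; simp [S, hv]
    by_cases hi'' : i = cnt d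
    · subst hi''; simp [S]
    simp [hi, hi', hi'', S]
  rw [hS, List.length_replicate] at h3
  have h4 := RunsIn.clear (var d) (S (g u env))
  refine (h1.seq (h2.seq (h3.seq h4))).congr ?_ ?_
  · funext i
    by_cases hi : i = tgt e
    · subst hi; simp [S]
    by_cases hi' : i = var d
    · subst hi'; simp [hv]
    by_cases hi'' : i = cnt d
    · subst hi''; simp [S, hc]
    simp [hi, hi', hi'', S]
  · have := Nat.mul_le_mul_right (Polynomial.eval (B + Polynomial.eval B Q) P + 2) hQ
    simp [h0, S, add_assoc]
    omega

/-- Reading a stack empties it. The value is therefore copied to the target and to a scratch target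
at once, and the latter refills the variable. -/
theorem EmitsNat.var {i : ℕ} : EmitsNat d fun _ env => env i := by
  refine ⟨fun e => (StackProg.loop (Stk.var i) fun _ =>
    (StackProg.push (tgt (e + 1)) none).seq (.push (tgt e) none)).seq
      (StackProg.loop (tgt (e + 1)) fun _ => .push (Stk.var i) none), 5 * Polynomial.X + 2,
    fun u env B hB => ?_⟩
  have hi := hB.le i
  refine ⟨?_, fun e s hs => ?_⟩
  · simp
    omega
  have h0 : s (tgt (e + 1)) = [] := hs.tgt _ (by omega)
  have hv : s (Stk.var i) = marks (env i) := hs.var i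
  have h1 := RunsIn.transfer₂ (k := Stk.var i) (k' := tgt (e + 1)) (k'' := tgt e) (by simp)
    (by simp) (by simp) (fun _ => none) (fun _ => none) s
  have h2 := h1.seq (RunsIn.transfer (k := tgt (e + 1)) (k' := Stk.var i) (by simp)
    (fun _ => none) _)
  refine h2.congr ?_ ?_
  · funext j
    by_cases hj : j = tgt e
    · subst hj; simp [hv]
    by_cases hj' : j = Stk.var i
    · subst hj'; simp [h0, hv]
    by_cases hj'' : j = tgt (e + 1)
    · subst hj''; simp [h0]
    simp [hj, hj', hj'']
  · simp [h0, hv]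
    omega

theorem EmitsNat.length : EmitsNat d fun u _ => u.length := by
  refine ⟨fun e => (StackProg.loop inp fun x =>
    (StackProg.push (tgt (e + 1)) x).seq (.push (tgt e) none)).seq
      (StackProg.loop (tgt (e + 1)) fun x => .push inp x), 5 * Polynomial.X + 2,
    fun u env B hB => ?_⟩
  have hi := hB.length_le
  refine ⟨?_, fun e s hs => ?_⟩
  · simp
    omega
  have h0 : s (tgt (e + 1)) = [] := hs.tgt _ (by omega)
  have hv : s inp = u.map some := hs.inp
  have h1 := RunsIn.transfer₂ (k := inp) (k' := tgt (e + 1)) (k'' := tgt e) (by simp)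
    (by simp) (by simp) (fun x => x) (fun _ => none) s
  have h2 := h1.seq (RunsIn.transfer (k := tgt (e + 1)) (k' := inp) (by simp) (fun x => x) _)
  refine h2.congr ?_ ?_
  · funext j
    by_cases hj : j = tgt e
    · subst hj; simp [hv, Function.comp_def]
    by_cases hj' : j = inp
    · subst hj'; simp [h0]
    by_cases hj'' : j = tgt (e + 1)
    · subst hj''; simp [h0]
    simp [hj, hj', hj'']
  · simp [h0, hv]
    omega

/-- The letter at a given position of the input word. -/
theorem Emits.letter {g : List Letter → (ℕ → ℕ) → ℕ} (hg : EmitsNat d g) :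
    Emits d fun u env => (u[g u env]?).toList.map some := by
  obtain ⟨q, Q, hq⟩ := hg
  refine ⟨fun e => (q (e + 1)).seq ((StackProg.loop (tgt (e + 1)) fun _ =>
    .pop inp fun x => x.elim .skip fun x => .push (tgt (e + 2)) x).seq
      ((StackProg.pop inp fun x => x.elim .skip fun x =>
        (StackProg.push inp x).seq (.push (tgt e) x)).seq
      (StackProg.loop (tgt (e + 2)) fun x => .push inp x))), 4 * Q + 2 * Polynomial.X + 5,
    fun u env B hB => ?_⟩
  have hQ := (hq u env B hB).1
  simp only [List.length_replicate] at hQ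
  refine ⟨?_, fun e s hs => ?_⟩
  · refine Nat.le_trans (m := 1) ?_ (by simp)
    rcases u[g u env]? with _ | x <;> simp
  obtain ⟨w, hw⟩ : ∃ w, w = u.map some := ⟨_, rfl⟩
  have hres : (u[g u env]?).toList.map some = (w[g u env]?).toList := by
    rw [hw, List.getElem?_map]
    rcases u[g u env]? with _ | x <;> rfl
  have h0 : s (tgt (e + 1)) = [] := hs.tgt _ (by omega)
  have h0' : s (tgt (e + 2)) = [] := hs.tgt _ (by omega)
  have hv : s inp = w := hs.inp.trans hw.symm
  have h1 := (hq u env B hB).2 (e + 1) s (hs.mono le_rfl (by omega))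
  simp only [h0, List.append_nil, List.reverse_replicate] at h1
  beta_reduce
  rw [hres]
  generalize g u env = n at *
  -- After `j` rounds the first `j` letters lie reversed on a scratch target. Beyond the end of the
  -- word, `take` and `drop` stay constant, as do the stacks, because popping the empty input has no
  -- effect.
  let S : ℕ → Stk → List (Option Letter) := fun j =>
    Function.update (Function.update (Function.update s (tgt (e + 1)) (marks (n - j)))
      inp (w.drop j)) (tgt (e + 2)) (w.take j).reverse
  have h2 := RunsIn.loop_of_forall (k := tgt (e + 1)) (t := 2)
    (f := fun _ => .pop inp fun x => x.elim .skip fun x => .push (tgt (e + 2)) x)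
    (marks n) S (fun j => by simp [S]) fun j hj => by
      have hinp : Function.update (S j) (tgt (e + 1)) ((marks n).drop (j + 1)) inp =
          w.drop j := by simp [S]
      refine RunsIn.pop (t := 1) ?_
      rw [hinp]
      rcases lt_or_ge j w.length with hlt | hge
      · rw [List.drop_eq_getElem_cons hlt]
        refine (RunsIn.push _ _ _).congr ?_ le_rfl
        funext i
        by_cases hi : i = tgt (e + 2)
        · subst hi
          have e₁ : (w.take (j + 1)).reverse = w[j] :: (w.take j).reverse := by
            simp
          simp [S, e₁]
        by_cases hi' : i = inp
        · subst hi'; simp [S]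
        by_cases hi'' : i = tgt (e + 1)
        · subst hi''; simp [S]
        simp [hi, hi', hi'', S]
      · have hge' : w.length ≤ j + 1 := by omega
        rw [List.drop_eq_nil_of_le hge]
        refine (RunsIn.skip _).congr ?_ le_rfl
        funext i
        by_cases hi : i = tgt (e + 2)
        · subst hi
          have e₁ := List.take_of_length_le hge
          have e₂ := List.take_of_length_le hge'
          simp only [S, Function.update_self, e₂, ne_eq, reduceCtorEq, not_false_eq_true,
            Function.update_of_ne, Stk.tgt.injEq, show ¬ e + 2 = e + 1 by omega, e₁]
        by_cases hi' : i = inp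
        · subst hi'; simp [S, hge']
        by_cases hi'' : i = tgt (e + 1)
        · subst hi''; simp [S]
        simp [hi, hi', hi'', S]
  have hS : S 0 = Function.update s (tgt (e + 1)) (marks n) := by
    funext i
    by_cases hi : i = tgt (e + 2)
    · subst hi; simp [S, h0']
    by_cases hi' : i = inp
    · subst hi'; simp [S, hv]
    by_cases hi'' : i = tgt (e + 1)
    · subst hi''; simp [S]
    simp [hi, hi', hi'', S]
  rw [hS, List.length_replicate] at h2
  let s₃ := Function.update (S n) (tgt e) ((w[n]?).toList ++ s (tgt e))
  have h3 : RunsIn (StackProg.pop inp fun x => x.elim .skip fun x =>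
      (StackProg.push inp x).seq (.push (tgt e) x)) (S n) s₃ 3 := by
    have hinp : S n inp = w.drop n := by simp [S]
    refine RunsIn.pop (t := 2) ?_
    rw [hinp]
    rcases lt_or_ge n w.length with hlt | hge
    · rw [List.drop_eq_getElem_cons hlt]
      refine ((RunsIn.push _ _ _).seq (RunsIn.push _ _ _)).congr ?_ le_rfl
      funext i
      by_cases hi : i = tgt e
      · subst hi
        simp [S, s₃, hlt]
      by_cases hi' : i = inp
      · subst hi'; simp [S, s₃]
      simp [hi, hi', s₃]
    · rw [List.drop_eq_nil_of_le hge]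
      refine (RunsIn.skip _).congr ?_ (by omega)
      funext i
      by_cases hi : i = tgt e
      · subst hi
        simp [S, s₃, hge]
      by_cases hi' : i = inp
      · subst hi'; simp [S, s₃, hge]
      simp [hi, hi', s₃]
  have h4 := RunsIn.transfer (k := tgt (e + 2)) (k' := inp) (by simp) (fun x => x) s₃
  refine (h1.seq (h2.seq (h3.seq h4))).congr ?_ ?_
  · funext i
    by_cases hi : i = tgt e
    · subst hi
      rcases h : w[n]? with _ | x <;> simp [s₃, h]
    by_cases hi' : i = inp
    · subst hi'; simp [S, hv, s₃]
    by_cases hi'' : i = tgt (e + 1)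
    · subst hi''; simp [S, h0, s₃]
    by_cases hi₃ : i = tgt (e + 2)
    · subst hi₃; simp [h0']
    simp [hi, hi', hi'', hi₃, S, s₃]
  · have := hB.length_le
    have hlen : w.length = u.length := by simp [hw]
    simp [S, s₃]
    omega

end StackProg

/-! ### Binary numerals and the passage to fpt time -/

namespace StackProg

open Stk

variable {d : ℕ}

theorem bits_eq_cons {x : ℕ} (hx : x ≠ 0) : x.bits = x.bodd :: (x / 2).bits := by
  conv_lhs => rw [← Nat.bit_bodd_div2 x]
  rw [Nat.bits_append_bit, Nat.div2_val]
  intro h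
  have := Nat.bit_bodd_div2 x
  rw [h] at this
  by_contra hb
  simp only [Bool.not_eq_true] at hb
  rw [hb] at this
  exact hx this.symm

/-- Halving a number in unary: half of the stack `a` is moved to `b`, the remainder to `c`. -/
theorem RunsIn.halve {a b c : Stk} (hab : a ≠ b) (hac : a ≠ c) (hbc : b ≠ c) :
    ∀ (x : ℕ) (s : Stk → List (Option Letter)) (_ : s a = marks x) (_ : s c = []),
      RunsIn (StackProg.loop a fun _ => .pop a fun o => o.elim (.push c none)
        fun _ => .push b none) s
        (Function.update (Function.update (Function.update s a []) b (marks (x / 2) ++ s b)) c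
          (marks (x % 2))) (3 * x + 1)
  | 0, s, ha, hc => by
    refine (RunsIn.loop_nil (by simpa using ha)).congr ?_ le_rfl
    funext i
    by_cases hi : i = c
    · subst hi; simp [hc]
    by_cases hi : i = b
    · subst hi; simp [hbc]
    by_cases hi : i = a
    · subst hi; simp [*]
    simp [*]
  | 1, s, ha, hc => by
    refine (RunsIn.loop_cons (a := none) (l := []) (by simpa using ha)
      (RunsIn.pop (t := 1) (s' := Function.update (Function.update s a []) c [none]) ?_)
      (RunsIn.loop_nil (by simp [hac]))).congr ?_ le_rfl
    · simp only [Function.update_self, List.head?_nil, Option.elim]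
      refine (RunsIn.push _ _ _).congr ?_ le_rfl
      simp [hac.symm, hc]
    · funext i
      by_cases hi : i = c
      · subst hi; simp
      by_cases hi : i = b
      · subst hi; simp [hbc, hab.symm]
      by_cases hi : i = a
      · subst hi; simp [*]
      simp [*]
  | x + 2, s, ha, hc => by
    have h1 := RunsIn.halve hab hac hbc x
      (Function.update (Function.update s a (marks x)) b (none :: s b)) (by simp [hab])
      (by simp [hac.symm, hbc.symm, hc])
    refine (RunsIn.loop_cons (a := none) (l := marks (x + 1)) (by rw [ha]; rfl)
      (RunsIn.pop (t := 1) ?_) h1).congr ?_ (by omega)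
    · simp only [Function.update_self, List.replicate_succ, List.head?_cons, Option.elim]
      refine (RunsIn.push _ _ _).congr ?_ le_rfl
      simp [hab.symm]
    · funext i
      by_cases hi : i = c
      · subst hi; simp
      by_cases hi : i = b
      · subst hi; simp [hbc, List.replicate_succ']
      by_cases hi : i = a
      · subst hi; simp [*]
      simp [*]

/-- Writing the number on the target `e + 1` in binary on the target `e`. -/
def binaryProg (e : ℕ) : Prog :=
  StackProg.loop (tgt (e + 1)) fun _ => (StackProg.push (tgt (e + 1)) none).seq
    ((StackProg.loop (tgt (e + 1)) fun _ => .pop (tgt (e + 1)) fun o =>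
      o.elim (.push (tgt (e + 3)) none) fun _ => .push (tgt (e + 2)) none).seq
    ((StackProg.pop (tgt (e + 3)) fun o => o.elim (.push (tgt e) (some .zero))
      fun _ => .push (tgt e) (some .one)).seq
    (StackProg.loop (tgt (e + 2)) fun _ => .push (tgt (e + 1)) none)))

/-- Writing a number in binary. -/
theorem RunsIn.binary (e : ℕ) :
    ∀ (x : ℕ) (s : Stk → List (Option Letter)) (_ : s (tgt (e + 1)) = marks x)
      (_ : s (tgt (e + 2)) = []) (_ : s (tgt (e + 3)) = []),
      RunsIn (binaryProg e) s
        (Function.update (Function.update s (tgt (e + 1)) []) (tgt e)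
          (((binaryWord x).map some).reverse ++ s (tgt e))) (x * (6 * x + 8) + 1) := by
  intro x
  induction x using Nat.strong_induction_on with
  | _ x ih =>
    intro s ha hb hc
    rcases Nat.eq_zero_or_pos x with rfl | hx
    · refine (RunsIn.loop_nil (by simpa using ha)).congr ?_ (by simp)
      have h0 : Function.update s (tgt (e + 1)) [] = s := by
        rw [Function.update_eq_self_iff]; exact ha.symm
      simp [binaryWord, h0]
    -- The loop removes one mark merely to test for zero; this push puts it back before halving.
    have h1 : RunsIn (StackProg.push (tgt (e + 1)) none)
        (Function.update s (tgt (e + 1)) (marks (x - 1))) s 1 := by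
      refine (RunsIn.push _ _ _).congr ?_ le_rfl
      simp only [Function.update_idem, Function.update_self, ← List.replicate_succ]
      rw [Nat.sub_add_cancel hx, Function.update_eq_self_iff]
      exact ha.symm
    have h2 := RunsIn.halve (a := tgt (e + 1)) (b := tgt (e + 2)) (c := tgt (e + 3)) (by simp)
      (by simp) (by simp) x s ha hc
    let s₂ := Function.update (Function.update s (tgt (e + 1)) []) (tgt (e + 2)) (marks (x / 2))
    let y : Letter := bif x.bodd then .one else .zero
    have h3 : RunsIn (StackProg.pop (tgt (e + 3)) fun o => o.elim (.push (tgt e) (some .zero))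
          fun _ => .push (tgt e) (some .one)) (Function.update s₂ (tgt (e + 3)) (marks (x % 2)))
          (Function.update s₂ (tgt e) (some y :: s (tgt e))) 2 := by
      refine RunsIn.pop (t := 1) ?_
      rw [Nat.mod_two_of_bodd]
      have e₂ : Function.update s₂ (tgt (e + 3)) [] = s₂ := by
        rw [Function.update_eq_self_iff]; simp [s₂, hc]
      rcases hy : x.bodd with _ | _ <;>
      · simp only [Function.update_self, Bool.toNat_false, Bool.toNat_true, List.replicate_zero,
          List.replicate_one, List.head?_nil, List.head?_cons, Option.elim]
        refine (RunsIn.push _ _ _).congr ?_ le_rfl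
        simp [e₂, y, hy, s₂]
    have h4 := RunsIn.transfer (k := tgt (e + 2)) (k' := tgt (e + 1)) (by simp) (fun _ => none)
      (Function.update s₂ (tgt e) (some y :: s (tgt e)))
    have e4 : s (tgt (e + 2)) = [] := hb
    rw [hb, List.append_nil] at h2
    have h5 := ih (x / 2) (by omega) (Function.update (Function.update s (tgt (e + 1))
      (marks (x / 2))) (tgt e) (some y :: s (tgt e))) (by simp) (by simp [hb]) (by simp [hc])
    have e5 : Function.update (Function.update (Function.update s₂ (tgt e) (some y :: s (tgt e)))
        (tgt (e + 2)) []) (tgt (e + 1))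
        (((Function.update s₂ (tgt e) (some y :: s (tgt e)) (tgt (e + 2))).map
          (fun _ => none)).reverse ++ Function.update s₂ (tgt e) (some y :: s (tgt e))
            (tgt (e + 1))) =
        Function.update (Function.update s (tgt (e + 1))
          (marks (x / 2))) (tgt e) (some y :: s (tgt e)) := by
      funext i
      by_cases hi : i = tgt e
      · subst hi; simp
      by_cases hi' : i = tgt (e + 1)
      · subst hi'; simp [s₂]
      by_cases hi'' : i = tgt (e + 2)
      · subst hi''; simp [hb]
      simp [hi, hi', hi'', s₂]
    rw [e5] at h4
    refine (RunsIn.loop_cons (a := none) (l := marks (x - 1)) ?_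
      (h1.seq (h2.seq (h3.seq h4))) h5).congr ?_ ?_
    · rw [ha, ← List.replicate_succ, Nat.sub_add_cancel hx]
    · funext i
      by_cases hi : i = tgt e
      · subst hi
        simp [binaryWord, bits_eq_cons hx.ne', y]
      by_cases hi' : i = tgt (e + 1)
      · subst hi'; simp
      simp [hi, hi']
    · have hlen : (Function.update s₂ (tgt e) (some y :: s (tgt e)) (tgt (e + 2))).length =
        x / 2 := by simp [s₂]
      rw [hlen]
      -- Replacing `x / 2` by `x - 1` is crude, but it leaves `6 * x + 8` steps for the present
      -- round, which is what the quadratic bound allows.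
      have h6 : x / 2 * (6 * (x / 2) + 8) ≤ (x - 1) * (6 * x + 8) :=
        Nat.mul_le_mul (by omega) (by omega)
      have h7 : x * (6 * x + 8) = (x - 1) * (6 * x + 8) + (6 * x + 8) := by
        obtain ⟨z, rfl⟩ : ∃ z, x = z + 1 := ⟨x - 1, by omega⟩
        simp
        ring
      omega

theorem length_binaryWord_le (x : ℕ) : (binaryWord x).length ≤ x := by
  rw [binaryWord, List.length_map, Nat.size_eq_bits_len, Nat.size_le]
  exact Nat.lt_two_pow_self

/-- A number in binary. -/
theorem Emits.binary {g : List Letter → (ℕ → ℕ) → ℕ} (hg : EmitsNat d g) :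
    Emits d fun u env => (binaryWord (g u env)).map some := by
  obtain ⟨q, Q, hq⟩ := hg
  refine ⟨fun e => (q (e + 1)).seq (binaryProg e), Q + Q * (6 * Q + 8) + 1, fun u env B hB => ?_⟩
  have hQ := (hq u env B hB).1
  simp only [List.length_replicate] at hQ
  refine ⟨?_, fun e s hs => ?_⟩
  · have := length_binaryWord_le (g u env)
    simp
    omega
  have h0 : s (tgt (e + 1)) = [] := hs.tgt _ (by omega)
  have h1 := (hq u env B hB).2 (e + 1) s (hs.mono le_rfl (by omega))
  simp only [h0, List.append_nil, List.reverse_replicate] at h1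
  refine (h1.seq (RunsIn.binary e (g u env) _ (by simp)
    (by simpa using hs.tgt (e + 2) (by omega))
    (by simpa using hs.tgt (e + 3) (by omega)))).congr ?_ ?_
  · simp [← h0]
  · have := Nat.mul_le_mul hQ (Nat.add_le_add_right (Nat.mul_le_mul_left 6 hQ) 8)
    simp [-mul_eq_mul_left_iff]
    omega

theorem Polynomial.eval_mono (P : Polynomial ℕ) {a b : ℕ} (h : a ≤ b) : P.eval a ≤ P.eval b := by
  simp only [Polynomial.eval_eq_sum_range]
  exact Finset.sum_le_sum fun i _ => Nat.mul_le_mul_left _ (Nat.pow_le_pow_left h i)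

/-- This separates `|u|` from `k`: a monomial of degree `i` yields the factor `(b + 1) ^ i`, and the
base is at least 1, so the largest exponent dominates. -/
theorem Polynomial.eval_mul_le (P : Polynomial ℕ) (a b : ℕ) :
    P.eval (a * (b + 1)) ≤ P.eval a * (b + 1) ^ P.natDegree := by
  simp only [Polynomial.eval_eq_sum_range, Finset.sum_mul]
  refine Finset.sum_le_sum fun i hi => ?_
  rw [mul_pow, ← mul_assoc]
  exact Nat.mul_le_mul_left _ (Nat.pow_le_pow_right (by omega)
    (Nat.lt_succ_iff.1 (Finset.mem_range.1 hi)))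

theorem computable_succ_pow (n : ℕ) : Computable fun k : ℕ => (k + 1) ^ n := by
  refine Primrec.to_comp ?_
  induction n with
  | zero => simpa using Primrec.const 1
  | succ n ih => simpa [pow_succ] using Primrec.nat_mul.comp ih Primrec.succ

/-- A map on parameterized instances is computable in fpt time if its result can be written in
polynomial time, from the parameter in unary. -/
theorem computableInFptTime_of_emits {r : List Letter × ℕ → List Letter × ℕ}
    (h : Emits 1 fun u env => pairWord (r (u, env 0))) : ComputableInFptTime r := by
  obtain ⟨p, P, hp⟩ := h
  obtain ⟨M, hM⟩ := exists_machine ((StackProg.loop inp fun x : Option Letter =>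
    x.elim (.push (var 0) none) fun a => .push (tgt 0) (some a)).seq
      ((StackProg.loop (tgt 0) fun x => .push inp x).seq ((p 0).seq
        ((StackProg.loop inp fun _ => .skip).seq ((StackProg.loop (var 0) fun _ => .skip).seq
          (StackProg.loop (tgt 0) fun x => .push inp x)))))) inp
  let T : Polynomial ℕ := 7 * Polynomial.X + 3 * P + 6
  refine ⟨M, T.comp (Polynomial.X + 1), fun k => (k + 1) ^ T.natDegree, computable_succ_pow _,
    fun u k => ?_⟩
  let env : ℕ → ℕ := Function.update (fun _ => 0) 0 k
  have hB : Bounded 1 u env (u.length + k) := by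
    refine ⟨by omega, fun i => ?_, fun i hi => ?_⟩
    · by_cases hi : i = 0
      · subst hi; simp [env]
      · simp [env, hi]
    · simp [env, show i ≠ 0 by omega]
  obtain ⟨hlen, hrun⟩ := hp u env _ hB
  have he : env 0 = k := by simp [env]
  beta_reduce at hlen hrun
  rw [he] at hlen hrun
  let z : Stk → List (Option Letter) := fun _ => []
  have h1 : ∀ (v : List Letter) (t : List (Option Letter)),
      RunsIn (StackProg.loop inp fun x : Option Letter => x.elim (.push (var 0) none)
      fun a => .push (tgt 0) (some a)) (Function.update (Function.update z inp (pairWord (v, k)))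
        (tgt 0) t) (Function.update (Function.update z (var 0) (marks k)) (tgt 0)
          ((v.map some).reverse ++ t)) (2 * (v.length + k) + 1) := by
    intro v
    induction v with
    | nil =>
      intro t
      have h := RunsIn.loop_of_forall (k := inp) (t := 1) (f := fun x : Option Letter =>
        x.elim (.push (var 0) none) fun a => .push (tgt 0) (some a)) (marks k) (fun j =>
        Function.update (Function.update (Function.update z inp (marks (k - j))) (var 0) (marks j))
          (tgt 0) t) (fun j => by simp) fun j hj => by
          simp only [List.getElem_replicate, Option.elim]
          refine (RunsIn.push _ _ _).congr ?_ le_rfl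
          funext i
          by_cases hi : i = tgt 0
          · subst hi; simp
          by_cases hi' : i = var 0
          · subst hi'; simp [List.replicate_succ]
          by_cases hi'' : i = inp
          · subst hi''; simp
          simp [hi, hi', hi'']
      have e0 : Function.update (Function.update (Function.update z inp (marks (k - 0))) (var 0)
          (marks 0)) (tgt 0) t = Function.update (Function.update z inp (pairWord ([], k)))
            (tgt 0) t := by
        funext i
        by_cases hi : i = tgt 0
        · subst hi; simp
        by_cases hi' : i = var 0
        · subst hi'; simp [z]
        by_cases hi'' : i = inp
        · subst hi''; simp [pairWord]
        simp [hi, hi', hi'']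
      rw [e0] at h
      refine h.congr ?_ (by simp; omega)
      funext i
      by_cases hi : i = tgt 0
      · subst hi; simp
      by_cases hi' : i = var 0
      · subst hi'; simp
      by_cases hi'' : i = inp
      · subst hi''; simp [z]
      simp [hi, hi', hi'']
    | cons a v ih =>
      intro t
      refine (RunsIn.loop_cons (k := inp) (t := 1) (a := some a) (l := pairWord (v, k))
        (f := fun x : Option Letter =>
          x.elim (.push (var 0) none) fun a => .push (tgt 0) (some a))
        (s := Function.update (Function.update z inp (pairWord (a :: v, k))) (tgt 0) t)
        (by simp [pairWord]) ((RunsIn.push (tgt 0) (some a) _).congr ?_ le_rfl)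
            (ih (some a :: t))).congr (by simp) ?_
      · funext i
        by_cases hi : i = tgt 0
        · subst hi; simp
        by_cases hi'' : i = inp
        · subst hi''; simp
        simp [hi, hi'']
      · simp
        omega
  have h1 := h1 u []
  have e1 : Function.update (Function.update z inp (pairWord (u, k))) (tgt 0) [] =
      Function.update z inp (pairWord (u, k)) := by
    rw [Function.update_eq_self_iff]; simp [z]
  rw [e1] at h1
  have h2 := RunsIn.transfer (k := tgt 0) (k' := inp) (by simp) (fun x => x)
    (Function.update (Function.update z (var 0) (marks k)) (tgt 0) ((u.map some).reverse ++ []))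
  let s := Function.update (Function.update z (var 0) (marks k)) inp (u.map some)
  have h2 := h2.congr (s₁ := s) (t' := 2 * u.length + 1) (by
    funext i
    by_cases hi : i = inp
    · subst hi; simp [s, z]
    by_cases hi' : i = tgt 0
    · subst hi'; simp [s, z]
    simp [hi, hi', s]) (by simp)
  have h3 := hrun 0 s ⟨by simp [s], fun i => by
    by_cases hi : i = 0
    · subst hi; simp [env, s]
    · simp [env, s, hi, z], fun i _ => by simp [s, z], fun i _ => by simp [s, z]⟩
  have h4 := RunsIn.clear inp (Function.update s (tgt 0)
    ((pairWord (r (u, k))).reverse ++ s (tgt 0)))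
  obtain ⟨H⟩ := hM (pairWord (u, k)) (pairWord (r (u, k)))
    -- The output was pushed letter by letter and lies reversed on the target; the last transfer to
    -- `inp` restores its order.
    (7 * (u.length + k) + 3 * P.eval (u.length + k) + 5) (by
      refine (h1.seq (h2.seq (h3.seq (h4.seq ((RunsIn.clear (var 0) _).seq
        (RunsIn.transfer (k := tgt 0) (k' := inp) (by simp) (fun x => x) _)))))).congr ?_ ?_
      · funext i
        by_cases hi : i = inp
        · subst hi; simp [s, z]
        by_cases hi' : i = tgt 0
        · subst hi'; simp
        by_cases hi'' : i = var 0
        · subst hi''; simp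
        simp [hi, hi', hi'', s, z]
      · simp [s, z]
        omega)
  refine ⟨⟨H.toEvalsTo, H.steps_le_m.trans ?_⟩⟩
  have hT : 7 * (u.length + k) + 3 * P.eval (u.length + k) + 5 + 1 = T.eval (u.length + k) := by
    simp [T]
  rw [hT]
  -- The sum `|u| + k` is at most the product `(|u| + 1) * (k + 1)`, in which the two quantities can
  -- be separated.
  refine (Polynomial.eval_mono T (b := (u.length + 1) * (k + 1)) (by nlinarith)).trans ?_
  refine (Polynomial.eval_mul_le T _ _).trans ?_
  simp

end StackProg

/-! ### The reduction map on words -/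

/-- The letters between the semicolons of a word, in order: `field u j` is what stands between the
`j`-th semicolon (or the beginning of the word) and the next one (or the end of the word). -/
def field : List Letter → ℕ → List Letter
  | [], _ => []
  | x :: u, j =>
    if x = .semicolon then (if j = 0 then [] else field u (j - 1))
    else (if j = 0 then [x] else []) ++ field u j

/-- The number of semicolons of a word. -/
def semis (u : List Letter) : ℕ := u.count .semicolon

/-- The entries of a permutation `ρ` of `E` points that follow the first `n` points. -/
def extWord (n E : ℕ) (ρ : ℕ → ℕ) : List Letter :=
  (List.range E).flatMap fun q => binaryWord (n + ρ q + 1) ++ [.comma]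

/-- The cycle on the points `pair 0 0, …, pair k 0`. -/
def cyclePerm : ℕ → Equiv.Perm ℕ
  | 0 => 1
  | k + 1 => Equiv.swap (Nat.pair k 0) (Nat.pair (k + 1) 0) * cyclePerm k

/-- The permutation that moves a token from `pair t 0` to `pair (t + 1) 0`, checks that the row `t`
holds the number `x`, and writes the number `y` to the row `t + 1`. -/
def stepPerm (t x y : ℕ) : Equiv.Perm ℕ :=
  Equiv.swap (Nat.pair t 0) (Nat.pair (t + 1) 0) *
    (Equiv.swap (Nat.pair t 1) (Nat.pair t (x + 1)) *
      Equiv.swap (Nat.pair (t + 1) 1) (Nat.pair (t + 1) (y + 1)))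

/-- The number of auxiliary points. -/
def auxPoints (k m : ℕ) : ℕ := (k + m + 3) ^ 2

/-- The word that an input word is mapped to. -/
def outWord (g : ℕ → ℕ) (u : List Letter) (k : ℕ) : List Letter :=
  if (field u 0).length = 0 then [] else
  if semis u ≤ 1 then [] else
  if (field u (semis u)).length = 0 then
    List.replicate (auxPoints k (semis u - 2)) .one ++ field u 0 ++ [.semicolon] ++
    (field u 1 ++ extWord (field u 0).length (auxPoints k (semis u - 2)) (cyclePerm k) ++
      [.semicolon]) ++
    (List.range (k + 1)).flatMap fun t => (List.range (semis u - 2)).flatMap fun j =>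
      (List.range (semis u - 2 + 1)).flatMap fun i =>
        if g i ≤ j + 1 then
          field u (j + 2) ++ extWord (field u 0).length (auxPoints k (semis u - 2))
            (stepPerm t i (if t + 1 = k then 0 else j + 1)) ++ [.semicolon]
        else []
  else []

theorem cyclePerm_pair_zero (k r : ℕ) : cyclePerm k (Nat.pair r 0) =
    if r = 0 then Nat.pair k 0 else if r ≤ k then Nat.pair (r - 1) 0 else Nat.pair r 0 := by
  induction k with
  | zero =>
    rcases Nat.eq_zero_or_pos r with rfl | hr
    · simp [cyclePerm]
    · simp [cyclePerm, hr.ne']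
  | succ k ih =>
    rw [cyclePerm, Equiv.Perm.mul_apply, ih]
    by_cases h : r = 0
    · simp [h]
    by_cases h' : r ≤ k
    · simp only [h, h', if_true, if_false, show r ≤ k + 1 by omega]
      refine Equiv.swap_apply_of_ne_of_ne ?_ ?_ <;>
      · rw [ne_eq, Nat.pair_eq_pair]
        omega
    · simp only [h, h', if_false]
      by_cases h'' : r = k + 1
      · subst h''; simp
      · rw [if_neg (by omega)]
        refine Equiv.swap_apply_of_ne_of_ne ?_ ?_ <;>
        · rw [ne_eq, Nat.pair_eq_pair]
          omega

theorem cyclePerm_pair_succ (k r c : ℕ) :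
    cyclePerm k (Nat.pair r (c + 1)) = Nat.pair r (c + 1) := by
  induction k with
  | zero => rfl
  | succ k ih =>
    rw [cyclePerm, Equiv.Perm.mul_apply, ih]
    exact Equiv.swap_apply_of_ne_of_ne (by simp) (by simp)

/-- The recursion is turned into a loop over positions that tests the number of preceding
semicolons, a form covered by the closure properties of `Emits`. -/
theorem field_eq_flatMap (u : List Letter) (j : ℕ) :
    field u j = (List.range u.length).flatMap fun p =>
      if (u.take p).count .semicolon = j then
        (if u[p]? = some .semicolon then [] else (u[p]?).toList) else [] := by
  induction u generalizing j with
  | nil => simp [field]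
  | cons x u ih =>
    rw [field, List.length_cons, List.range_succ_eq_map, List.flatMap_cons, List.flatMap_map]
    by_cases hx : x = .semicolon
    · rcases j with _ | j
      · simp [hx]
      · simp [hx, ih]
    · rcases j with _ | j <;> simp [hx, ih]

theorem count_take (u : List Letter) (p : ℕ) :
    (u.take p).count .semicolon =
      ((List.range p).map fun q => if u[q]? = some .semicolon then 1 else 0).sum := by
  induction p with
  | zero => simp
  | succ p ih =>
    rw [List.range_succ, List.map_append, List.sum_append, ← ih, List.take_add_one,
      List.count_append]
    rcases h : u[p]? with _ | x
    · simp [h]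
    · cases x <;> simp [h]

/-! ### The output word can be written in polynomial time -/

namespace StackProg

variable {d : ℕ}

theorem Emits.congr {f f' : List Letter → (ℕ → ℕ) → List (Option Letter)} (h : Emits d f)
    (hf : ∀ u env, f u env = f' u env) : Emits d f' := by
  have : f = f' := funext fun u => funext fun env => hf u env
  exact this ▸ h

theorem EmitsNat.congr {f f' : List Letter → (ℕ → ℕ) → ℕ} (h : EmitsNat d f)
    (hf : ∀ u env, f u env = f' u env) : EmitsNat d f' :=
  Emits.congr h fun u env => by rw [hf]

theorem Emits.ite_le {a b : List Letter → (ℕ → ℕ) → ℕ}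
    {f f' : List Letter → (ℕ → ℕ) → List (Option Letter)} (ha : EmitsNat d a) (hb : EmitsNat d b)
    (hf : Emits d f) (hf' : Emits d f') :
    Emits d fun u env => if a u env ≤ b u env then f u env else f' u env :=
  (Emits.ite_eq_zero (ha.sub hb) hf hf').congr fun u env => by simp only [Nat.sub_eq_zero_iff_le]

theorem Emits.ite_eq {a b : List Letter → (ℕ → ℕ) → ℕ}
    {f f' : List Letter → (ℕ → ℕ) → List (Option Letter)} (ha : EmitsNat d a) (hb : EmitsNat d b)
    (hf : Emits d f) (hf' : Emits d f') :
    Emits d fun u env => if a u env = b u env then f u env else f' u env :=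
  (Emits.ite_le ha hb (Emits.ite_le hb ha hf hf') hf').congr fun u env => by
    by_cases h : a u env = b u env
    · simp [h]
    · rw [if_neg h]
      split_ifs <;> first | rfl | omega

theorem EmitsNat.ite_le {a b f f' : List Letter → (ℕ → ℕ) → ℕ} (ha : EmitsNat d a)
    (hb : EmitsNat d b) (hf : EmitsNat d f) (hf' : EmitsNat d f') :
    EmitsNat d fun u env => if a u env ≤ b u env then f u env else f' u env :=
  (Emits.ite_le ha hb hf hf').congr fun u env => by beta_reduce; split_ifs <;> rfl

theorem EmitsNat.ite_eq {a b f f' : List Letter → (ℕ → ℕ) → ℕ} (ha : EmitsNat d a)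
    (hb : EmitsNat d b) (hf : EmitsNat d f) (hf' : EmitsNat d f') :
    EmitsNat d fun u env => if a u env = b u env then f u env else f' u env :=
  (Emits.ite_eq ha hb hf hf').congr fun u env => by beta_reduce; split_ifs <;> rfl

theorem Emits.ite_letter {g : List Letter → (ℕ → ℕ) → ℕ}
    {f f' : List Letter → (ℕ → ℕ) → List (Option Letter)} (x : Letter) (hg : EmitsNat d g)
    (hf : Emits d f) (hf' : Emits d f') :
    Emits d fun u env => if u[g u env]? = some x then f u env else f' u env := by
  have h := Emits.branch (f := fun y => if y = some (some x) then f else f') (Emits.letter hg)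
    fun y => by split_ifs <;> assumption
  refine h.congr fun u env => ?_
  rcases u[g u env]? with _ | y
  · simp
  · by_cases hy : y = x <;> simp [hy]

theorem EmitsNat.ite_letter {g f f' : List Letter → (ℕ → ℕ) → ℕ} (x : Letter)
    (hg : EmitsNat d g) (hf : EmitsNat d f) (hf' : EmitsNat d f') :
    EmitsNat d fun u env => if u[g u env]? = some x then f u env else f' u env :=
  (Emits.ite_letter x hg hf hf').congr fun u env => by beta_reduce; split_ifs <;> rfl

theorem EmitsNat.sum {g : List Letter → (ℕ → ℕ) → ℕ}
    {f : List Letter → (ℕ → ℕ) → ℕ} (hg : EmitsNat d g) (hf : EmitsNat (d + 1) f) :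
    EmitsNat d fun u env => ((List.range (g u env)).map fun x =>
      f u (Function.update env d x)).sum := by
  refine (Emits.forRange hg hf).congr fun u env => ?_
  beta_reduce
  induction List.range (g u env) with
  | nil => rfl
  | cons x l ih => rw [List.flatMap_cons, ih, List.map_cons, List.sum_cons, marks, marks, marks,
      List.replicate_add]

theorem EmitsNat.bind {g f : List Letter → (ℕ → ℕ) → ℕ} (hg : EmitsNat d g)
    (hf : EmitsNat (d + 1) f) :
    EmitsNat d fun u env => f u (Function.update env d (g u env)) := Emits.bind hg hf

/-- Squaring is repeated addition of a stored value. General products are not needed, since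
`Nat.pair` involves only squares and sums. -/
theorem EmitsNat.sq {f : List Letter → (ℕ → ℕ) → ℕ} (hf : EmitsNat d f) :
    EmitsNat d fun u env => f u env * f u env := by
  refine (EmitsNat.bind hf (EmitsNat.sum (EmitsNat.var (i := d)) (EmitsNat.var (i := d)))).congr
    fun u env => ?_
  simp

theorem EmitsNat.pair {f g : List Letter → (ℕ → ℕ) → ℕ} (hf : EmitsNat d f) (hg : EmitsNat d g) :
    EmitsNat d fun u env => Nat.pair (f u env) (g u env) := by
  refine (EmitsNat.ite_le hg hf ((hf.sq.add hf).add hg) (hg.sq.add hf)).congr fun u env => ?_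
  simp only [Nat.pair]
  split_ifs <;> first | rfl | omega

theorem EmitsNat.swap {a b f : List Letter → (ℕ → ℕ) → ℕ} (ha : EmitsNat d a) (hb : EmitsNat d b)
    (hf : EmitsNat d f) :
    EmitsNat d fun u env => Equiv.swap (a u env) (b u env) (f u env) :=
  EmitsNat.ite_eq hf ha hb (EmitsNat.ite_eq hf hb ha hf)

theorem EmitsNat.stepPerm {t x y q : List Letter → (ℕ → ℕ) → ℕ} (ht : EmitsNat d t)
    (hx : EmitsNat d x) (hy : EmitsNat d y) (hq : EmitsNat d q) :
    EmitsNat d fun u env => stepPerm (t u env) (x u env) (y u env) (q u env) := by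
  have h1 := EmitsNat.const (d := d) 1
  have h0 := EmitsNat.const (d := d) 0
  exact (EmitsNat.swap (ht.pair h0) ((ht.add h1).pair h0) (EmitsNat.swap (ht.pair h1)
    (ht.pair (hx.add h1)) (EmitsNat.swap ((ht.add h1).pair h1) ((ht.add h1).pair (hy.add h1)) hq)))

/-- At most one summand is nonzero, so the bounded sum acts as a search for the row of the token.
The summands are shifted by 1 so that the sum 0 means "not found" and cannot be confused with the
value 0. -/
theorem cyclePerm_eq (k q : ℕ) : cyclePerm k q =
    if q = Nat.pair 0 0 then Nat.pair k 0 else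
    if ((List.range k).map fun r => if q = Nat.pair (r + 1) 0 then Nat.pair r 0 + 1 else 0).sum = 0
    then q else
      ((List.range k).map fun r => if q = Nat.pair (r + 1) 0 then Nat.pair r 0 + 1 else 0).sum
        - 1 := by
  obtain ⟨r, c, rfl⟩ : ∃ r c, q = Nat.pair r c := ⟨_, _, (Nat.pair_unpair q).symm⟩
  have hsum : ((List.range k).map fun s => if Nat.pair r c = Nat.pair (s + 1) 0 then
      Nat.pair s 0 + 1 else 0).sum =
      if c = 0 ∧ r ≠ 0 ∧ r ≤ k then Nat.pair (r - 1) 0 + 1 else 0 := by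
    induction k with
    | zero => simp
    | succ k ih =>
      rw [List.range_succ, List.map_append, List.sum_append, ih]
      simp only [List.map_cons, List.map_nil, List.sum_cons, List.sum_nil, Nat.pair_eq_pair]
      by_cases h : r = k + 1 ∧ c = 0
      · obtain ⟨rfl, rfl⟩ := h
        simp
      · rw [if_neg h, Nat.add_zero, Nat.add_zero]
        exact if_congr (by omega) rfl rfl
  rw [hsum]
  rcases c with _ | c
  · rw [cyclePerm_pair_zero]
    by_cases hr : r = 0
    · simp [hr]
    · by_cases hk : r ≤ k <;> simp [hr, hk, Nat.pair_eq_pair]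
  · rw [cyclePerm_pair_succ]
    simp [Nat.pair_eq_pair]

/-- The summation variable occupies slot `d` while slot `b` is read in the summand, whence `b < d`.
Slot `a` is read only outside the sum. -/
theorem EmitsNat.cyclePerm {a b : ℕ} (hb : b < d) :
    EmitsNat d fun _ env => cyclePerm (env a) (env b) := by
  have h0 : ∀ {d}, EmitsNat d fun _ _ => 0 := EmitsNat.const 0
  have h1 : ∀ {d}, EmitsNat d fun _ _ => 1 := EmitsNat.const 1
  have hs := EmitsNat.sum (d := d) (EmitsNat.var (i := a)) (EmitsNat.ite_eq (EmitsNat.var (i := b))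
    (((EmitsNat.var (i := d)).add h1).pair h0) (((EmitsNat.var (i := d)).pair h0).add h1) h0)
  refine (EmitsNat.ite_eq (EmitsNat.var (i := b)) (h0.pair h0) ((EmitsNat.var (i := a)).pair h0)
    (EmitsNat.ite_eq hs h0 (EmitsNat.var (i := b)) (hs.sub h1))).congr fun u env => ?_
  simp only [cyclePerm_eq, Function.update_self, Function.update_of_ne hb.ne]

theorem EmitsNat.count_take {p : ℕ} :
    EmitsNat d fun u env => (u.take (env p)).count .semicolon := by
  refine (EmitsNat.sum (EmitsNat.var (i := p)) (EmitsNat.ite_letter .semicolon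
    (EmitsNat.var (i := d)) (EmitsNat.const 1) (EmitsNat.const 0))).congr fun u env => ?_
  simp [_root_.count_take]

theorem EmitsNat.semis : EmitsNat d fun u _ => semis u := by
  refine (EmitsNat.bind EmitsNat.length (EmitsNat.count_take (p := d))).congr fun u env => ?_
  simp [_root_.semis]

theorem Emits.field {g : List Letter → (ℕ → ℕ) → ℕ} (hg : EmitsNat d g) :
    Emits d fun u env => (field u (g u env)).map some := by
  refine (Emits.bind hg (Emits.forRange EmitsNat.length (Emits.ite_eq
    (EmitsNat.count_take (p := d + 1)) (EmitsNat.var (i := d)) (Emits.ite_letter .semicolon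
      (EmitsNat.var (i := d + 1)) Emits.nil (Emits.letter (EmitsNat.var (i := d + 1))))
      Emits.nil))).congr fun u env => ?_
  rw [field_eq_flatMap, List.map_flatMap]
  refine List.flatMap_congr fun p _ => ?_
  simp only [Function.update_self, ne_eq, show ¬ d = d + 1 by omega, not_false_eq_true,
    Function.update_of_ne]
  split_ifs <;> rfl

theorem EmitsNat.length_field {g : List Letter → (ℕ → ℕ) → ℕ} (hg : EmitsNat d g) :
    EmitsNat d fun u env => (field u (g u env)).length := by
  refine (EmitsNat.bind hg (EmitsNat.sum EmitsNat.length (EmitsNat.ite_eq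
    (EmitsNat.count_take (p := d + 1)) (EmitsNat.var (i := d)) (EmitsNat.ite_letter .semicolon
      (EmitsNat.var (i := d + 1)) (EmitsNat.const 0) (EmitsNat.const 1))
      (EmitsNat.const 0)))).congr fun u env => ?_
  rw [field_eq_flatMap, List.length_flatMap]
  refine congrArg List.sum (List.map_congr_left fun p hp => ?_)
  simp only [Function.update_self, ne_eq, show ¬ d = d + 1 by omega, not_false_eq_true,
    Function.update_of_ne, List.getElem?_eq_getElem (List.mem_range.1 hp)]
  split_ifs <;> rfl

theorem Emits.extWord {n E f : List Letter → (ℕ → ℕ) → ℕ} {ρ : List Letter → (ℕ → ℕ) → ℕ → ℕ}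
    (hn : EmitsNat (d + 1) n) (hE : EmitsNat d E) (hf : EmitsNat (d + 1) f)
    (hn' : ∀ u env q, n u (Function.update env d q) = n u env)
    (hρ : ∀ u env q, f u (Function.update env d q) = ρ u env q) :
    Emits d fun u env => (extWord (n u env) (E u env) (ρ u env)).map some := by
  refine (Emits.forRange hE (Emits.append (Emits.binary ((hn.add hf).add (EmitsNat.const 1)))
    (Emits.single (some .comma)))).congr fun u env => ?_
  rw [_root_.extWord, List.map_flatMap]
  simp [hn', hρ]

theorem emits_outWord {g : ℕ → ℕ} (hg : ∀ d i, EmitsNat d fun _ env => g (env i)) :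
    Emits 1 fun u env => pairWord (outWord g u (env 0), env 0) := by
  refine Emits.append (?_ : Emits 1 fun u env => (outWord g u (env 0)).map some)
    (EmitsNat.var (i := 0))
  have hc : ∀ {d} c, EmitsNat d fun _ _ => c := EmitsNat.const
  have hv : ∀ {d} i, EmitsNat d fun _ env => env i := fun i => EmitsNat.var
  -- Variables: 0 holds `k`, 1 the degree, 2 the number of factors, 3 the number of auxiliary
  -- points, and 4, 5, 6 the loop variables `t`, `j`, `i`. The auxiliary point being written is
  -- variable 4 for the target, outside these loops, and variable 7 inside them.
  have hext : Emits 4 fun u env => (extWord (env 1) (env 3) (cyclePerm (env 0))).map some :=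
    Emits.extWord (hv 1) (hv 3) (EmitsNat.cyclePerm (a := 0) (b := 4) (by omega))
      (fun u env q => rfl) (fun u env q => rfl)
  have hext' : Emits 7 fun u env => (extWord (env 1) (env 3) (stepPerm (env 4) (env 6)
      (if env 4 + 1 = env 0 then 0 else env 5 + 1))).map some :=
    Emits.extWord (hv 1) (hv 3) (EmitsNat.stepPerm (hv 4) (hv 6) (EmitsNat.ite_eq
      ((hv 4).add (hc 1)) (hv 0) (hc 0) ((hv 5).add (hc 1))) (hv 7))
      (fun u env q => rfl) (fun u env q => rfl)
  have hloop := Emits.forRange (d := 4) ((hv 0).add (hc 1)) (Emits.forRange (hv 2)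
    (Emits.forRange ((hv 2).add (hc 1)) (Emits.ite_le (hg 7 6) ((hv 5).add (hc 1))
      ((Emits.append (Emits.field ((hv 5).add (hc 2))) hext').append
        (Emits.single (some .semicolon))) Emits.nil)))
  have hone : Emits 4 fun u env => (List.replicate (env 3) Letter.one).map some := by
    refine (Emits.forRange (hv 3) (Emits.single (some .one))).congr fun u env => ?_
    induction env 3 with
    | zero => rfl
    | succ n ih => rw [List.range_succ, List.flatMap_append, ih, List.replicate_succ']; simp
  have hmain := (((hone.append (Emits.field (hc 0))).append (Emits.single (some .semicolon))).append
    (((Emits.field (hc 1)).append hext).append (Emits.single (some .semicolon)))).append hloop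
  have hlet := Emits.bind (EmitsNat.length_field (hc 0)) (Emits.bind
    (EmitsNat.semis.sub (hc 2)) (Emits.bind ((((hv 0).add (hv 2)).add (hc 3)).sq) hmain))
  refine (Emits.ite_eq (EmitsNat.length_field (hc 0)) (hc 0) Emits.nil (Emits.ite_le EmitsNat.semis
    (hc 1) Emits.nil (Emits.ite_eq (EmitsNat.length_field EmitsNat.semis) (hc 0) hlet
      Emits.nil))).congr fun u env => ?_
  rw [outWord]
  split_ifs
  · rfl
  · rfl
  · simp [auxPoints, pow_two, List.map_flatMap, apply_ite (List.map some)]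
  · rfl

end StackProg

/-! ### The token and the rows -/

open MulOpposite

theorem cyclePerm_mul_swap (s x y : ℕ) :
    cyclePerm s * Equiv.swap (Nat.pair s (x + 1)) (Nat.pair s (y + 1)) =
      Equiv.swap (Nat.pair s (x + 1)) (Nat.pair s (y + 1)) * cyclePerm s := by
  rw [Equiv.mul_swap_eq_swap_mul, cyclePerm_pair_succ, cyclePerm_pair_succ]

/-- The product of the steps `0, …, s - 1`, if each step checks the number that the preceding one
has written. -/
theorem prod_stepPerm (x : ℕ → ℕ) (hx : x 0 = 0) (s : ℕ) :
    ((List.range s).map fun t => op (stepPerm t (x t) (x (t + 1)))).prod =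
      op (Equiv.swap (Nat.pair s 1) (Nat.pair s (x s + 1)) * cyclePerm s) := by
  induction s with
  | zero =>
    simp [hx, cyclePerm]
    rfl
  | succ s ih =>
    rw [List.range_succ, List.map_append, List.prod_append, ih, List.map_cons, List.map_nil,
      List.prod_cons, List.prod_nil, mul_one, ← op_mul]
    congr 1
    rw [stepPerm, cyclePerm]
    -- Token swaps act in column 0 and the others in columns from 1 on, and different rows are
    -- disjoint. So the swap written to row `s` can be moved next to the equal swap that checks it,
    -- and the two cancel; the swap in row `s + 1` remains.
    have h1 := cyclePerm_mul_swap s 0 (x s)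
    have h2 : Equiv.swap (Nat.pair s 1) (Nat.pair s (x s + 1)) *
        Equiv.swap (Nat.pair (s + 1) 1) (Nat.pair (s + 1) (x (s + 1) + 1)) =
        Equiv.swap (Nat.pair (s + 1) 1) (Nat.pair (s + 1) (x (s + 1) + 1)) *
        Equiv.swap (Nat.pair s 1) (Nat.pair s (x s + 1)) := by
      rw [Equiv.mul_swap_eq_swap_mul]
      congr 2 <;> exact Equiv.swap_apply_of_ne_of_ne (by simp [Nat.pair_eq_pair])
        (by simp [Nat.pair_eq_pair])
    have h3 : Equiv.swap (Nat.pair s 0) (Nat.pair (s + 1) 0) *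
        Equiv.swap (Nat.pair (s + 1) 1) (Nat.pair (s + 1) (x (s + 1) + 1)) =
        Equiv.swap (Nat.pair (s + 1) 1) (Nat.pair (s + 1) (x (s + 1) + 1)) *
        Equiv.swap (Nat.pair s 0) (Nat.pair (s + 1) 0) := by
      rw [Equiv.mul_swap_eq_swap_mul]
      congr 2 <;> exact Equiv.swap_apply_of_ne_of_ne (by simp [Nat.pair_eq_pair])
        (by simp [Nat.pair_eq_pair])
    rw [h2, ← mul_assoc (Equiv.swap (Nat.pair s 0) _), h3]
    simp only [mul_assoc]
    rw [← mul_assoc (Equiv.swap (Nat.pair s 1) _) (Equiv.swap (Nat.pair s 1) _),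
      Equiv.swap_mul_self, one_mul]

/-- The auxiliary permutation for the triple of a time `t`, the index `j` of the factor that is used
at this time, and the number `i` left by the preceding step. -/
def auxPerm (k : ℕ) (e : ℕ × ℕ × ℕ) : Equiv.Perm ℕ :=
  stepPerm e.1 e.2.2 (if e.1 + 1 = k then 0 else e.2.1 + 1)

/-- The effect of a sequence of steps on an auxiliary point. -/
def auxAct (k : ℕ) (L : List (ℕ × ℕ × ℕ)) (q : ℕ) : ℕ :=
  (L.map fun e => op (auxPerm k e)).prod.unop q

theorem auxAct_cons (k : ℕ) (e : ℕ × ℕ × ℕ) (L : List (ℕ × ℕ × ℕ)) (q : ℕ) :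
    auxAct k (e :: L) q = auxAct k L (auxPerm k e q) := by
  simp [auxAct]

theorem auxPerm_token (k : ℕ) (e : ℕ × ℕ × ℕ) (r : ℕ) : auxPerm k e (Nat.pair r 0) =
    Nat.pair (if r = e.1 then e.1 + 1 else if r = e.1 + 1 then e.1 else r) 0 := by
  rw [auxPerm, stepPerm, Equiv.Perm.mul_apply, Equiv.Perm.mul_apply,
    Equiv.swap_apply_of_ne_of_ne (x := Nat.pair r 0) (by simp) (by simp),
    Equiv.swap_apply_of_ne_of_ne (x := Nat.pair r 0) (by simp) (by simp),
    Equiv.swap_apply_def]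
  simp only [Nat.pair_eq_pair, and_true]
  split_ifs <;> rfl

/-- A single factor lifts the token by at most one row. -/
theorem exists_auxAct_token (k : ℕ) (L : List (ℕ × ℕ × ℕ)) (r : ℕ) :
    ∃ r' ≤ r + L.length, auxAct k L (Nat.pair r 0) = Nat.pair r' 0 := by
  induction L generalizing r with
  | nil => exact ⟨r, by simp, rfl⟩
  | cons e L ih =>
    rw [auxAct_cons, auxPerm_token]
    obtain ⟨r', h, h'⟩ := ih (if r = e.1 then e.1 + 1 else if r = e.1 + 1 then e.1 else r)
    refine ⟨r', h.trans ?_, h'⟩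
    simp only [List.length_cons]
    split_ifs <;> omega

/-- The token forces the times of the steps. -/
theorem map_fst_eq_range' (k : ℕ) (L : List (ℕ × ℕ × ℕ)) (r : ℕ)
    (h : auxAct k L (Nat.pair r 0) = Nat.pair (r + L.length) 0) :
    L.map Prod.fst = List.range' r L.length := by
  induction L generalizing r with
  | nil => rfl
  | cons e L ih =>
    rw [auxAct_cons, auxPerm_token] at h
    obtain ⟨r', h1, h2⟩ := exists_auxAct_token k L
      (if r = e.1 then e.1 + 1 else if r = e.1 + 1 then e.1 else r)
    rw [h, Nat.pair_eq_pair, List.length_cons] at h2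
    -- If the first factor did not lift the token, the remaining ones would be too few to reach the
    -- final row.
    have he : r = e.1 := by
      by_contra hne
      rw [if_neg hne] at h1
      split_ifs at h1 <;> omega
    rw [if_pos he, ← he, List.length_cons, add_comm L.length, ← add_assoc] at h
    rw [List.map_cons, List.length_cons, List.range'_succ, ih (r + 1) h, ← he]

theorem auxPerm_eq_self {k : ℕ} {e : ℕ × ℕ × ℕ} {r : ℕ} (c : ℕ) (h : r ≠ e.1) (h' : r ≠ e.1 + 1) :
    auxPerm k e (Nat.pair r c) = Nat.pair r c := by
  rw [auxPerm, stepPerm, Equiv.Perm.mul_apply, Equiv.Perm.mul_apply]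
  rw [Equiv.swap_apply_of_ne_of_ne (x := Nat.pair r c) (by simp [Nat.pair_eq_pair, h'])
      (by simp [Nat.pair_eq_pair, h']),
    Equiv.swap_apply_of_ne_of_ne (x := Nat.pair r c) (by simp [Nat.pair_eq_pair, h])
      (by simp [Nat.pair_eq_pair, h]),
    Equiv.swap_apply_of_ne_of_ne (by simp [Nat.pair_eq_pair, h])
      (by simp [Nat.pair_eq_pair, h'])]

theorem auxAct_eq_self {k : ℕ} {L : List (ℕ × ℕ × ℕ)} {r : ℕ} (c : ℕ) (h : ∀ e ∈ L, r < e.1) :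
    auxAct k L (Nat.pair r c) = Nat.pair r c := by
  induction L with
  | nil => rfl
  | cons e L ih =>
    have he := h e List.mem_cons_self
    rw [auxAct_cons, auxPerm_eq_self c (by omega) (by omega)]
    exact ih fun e he => h e (List.mem_cons_of_mem _ he)

theorem auxPerm_row (k : ℕ) (e : ℕ × ℕ × ℕ) (x : ℕ) : auxPerm k e (Nat.pair e.1 (x + 1)) =
    Nat.pair e.1 (if x = 0 then e.2.2 + 1 else if x = e.2.2 then 1 else x + 1) := by
  rw [auxPerm, stepPerm, Equiv.Perm.mul_apply, Equiv.Perm.mul_apply,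
    Equiv.swap_apply_of_ne_of_ne (x := Nat.pair e.1 (x + 1)) (by simp [Nat.pair_eq_pair])
      (by simp [Nat.pair_eq_pair]),
    Equiv.swap_apply_def (Nat.pair e.1 1)]
  simp only [Nat.pair_eq_pair, true_and, Nat.add_eq_right, Nat.add_right_cancel_iff]
  split_ifs <;> exact Equiv.swap_apply_of_ne_of_ne (by simp) (by simp)

theorem auxPerm_next_row (k : ℕ) (e : ℕ × ℕ × ℕ) : auxPerm k e (Nat.pair (e.1 + 1) 1) =
    Nat.pair (e.1 + 1) ((if e.1 + 1 = k then 0 else e.2.1 + 1) + 1) := by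
  rw [auxPerm, stepPerm, Equiv.Perm.mul_apply, Equiv.Perm.mul_apply, Equiv.swap_apply_left]
  rw [Equiv.swap_apply_of_ne_of_ne (a := Nat.pair e.1 1) (by simp [Nat.pair_eq_pair])
      (by simp [Nat.pair_eq_pair]), Equiv.swap_apply_of_ne_of_ne (by simp) (by simp)]

/-- Each step of the list checks the number left by the preceding one, where the first one checks
the number `x`. -/
def Linked : ℕ → List (ℕ × ℕ × ℕ) → Prop
  | _, [] => True
  | x, e :: L => e.2.2 = x ∧ Linked (e.2.1 + 1) L

/-- Here `x` is the number still recorded in the current row: earlier steps have sent column 1 to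
column `x + 1`. Only the next step can send it back, since later ones act on higher rows, and it
does so only by checking the same `x`. -/
theorem linked_of_auxAct {k : ℕ} (L : List (ℕ × ℕ × ℕ)) (r x : ℕ) (hr : r + L.length = k)
    (hL : L.map Prod.fst = List.range' r L.length)
    (hx : auxAct k L (Nat.pair r (x + 1)) = Nat.pair r 1)
    (h : ∀ r', r < r' → r' ≤ k → auxAct k L (Nat.pair r' 1) = Nat.pair r' 1) : Linked x L := by
  induction L generalizing r x with
  | nil => trivial
  | cons e L ih =>
    rw [List.map_cons, List.length_cons, List.range'_succ, List.cons.injEq] at hL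
    obtain ⟨he, hL⟩ := hL
    subst he
    rw [List.length_cons] at hr
    have hlt : ∀ e' ∈ L, e.1 < e'.1 := fun e' he' => by
      have := List.mem_map_of_mem (f := Prod.fst) he'
      rw [hL, List.mem_range'_1] at this
      omega
    refine ⟨?_, ?_⟩
    · rw [auxAct_cons, auxPerm_row, auxAct_eq_self _ hlt, Nat.pair_eq_pair] at hx
      have := hx.2
      split_ifs at this <;> omega
    · rcases L with _ | ⟨e', L⟩
      · trivial
      rw [List.length_cons] at hr
      refine ih (e.1 + 1) (e.2.1 + 1) (by simp; omega) hL ?_ fun r' h1 h2 => ?_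
      · have := h (e.1 + 1) (by omega) (by omega)
        rwa [auxAct_cons, auxPerm_next_row, if_neg (by omega)] at this
      · have := h r' (by omega) h2
        rwa [auxAct_cons, auxPerm_eq_self 1 (by omega) (by omega)] at this

/-- A step checks one plus the index of its predecessor, so the condition `g i ≤ j + 1` for
admitting it is the chain relation between the two indices. -/
theorem Linked.isChain {g : ℕ → ℕ} {x : ℕ} {L : List (ℕ × ℕ × ℕ)} (h : Linked x L)
    (hg : ∀ e ∈ L, g e.2.2 ≤ e.2.1 + 1) :
    (L.map fun e => e.2.1).IsChain fun i j => g (i + 1) ≤ j + 1 := by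
  induction L generalizing x with
  | nil => simp
  | cons e L ih =>
    have h' := ih h.2 fun e he => hg e (List.mem_cons_of_mem _ he)
    rcases L with _ | ⟨e', L⟩
    · simp
    · simp only [List.map_cons, List.isChain_cons_cons] at h' ⊢
      refine ⟨?_, h'⟩
      have := hg e' (by simp)
      rwa [h.2.1] at this

/-! ### Gluing permutations of old and auxiliary points -/

/-- The group of auxiliary permutations acts on `Fin n ⊕ ℕ`, here identified with `ℕ`. -/
def combPerm (n : ℕ) (a : Equiv.Perm (Fin n)) (ρ : Equiv.Perm ℕ) : Equiv.Perm ℕ :=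
  (finSumNatEquiv n).permCongr (Equiv.sumCongr a ρ)

theorem combPerm_lt {n : ℕ} (a : Equiv.Perm (Fin n)) (ρ : Equiv.Perm ℕ) (i : Fin n) :
    combPerm n a ρ i = a i := by
  simp [combPerm, finSumNatEquiv]

theorem combPerm_add {n : ℕ} (a : Equiv.Perm (Fin n)) (ρ : Equiv.Perm ℕ) (q : ℕ) :
    combPerm n a ρ (n + q) = n + ρ q := by
  simp [combPerm, finSumNatEquiv]

theorem combPerm_mul {n : ℕ} (a b : Equiv.Perm (Fin n)) (ρ σ : Equiv.Perm ℕ) :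
    combPerm n (a * b) (ρ * σ) = combPerm n a ρ * combPerm n b σ := by
  ext x
  rcases lt_or_ge x n with h | h
  · have h1 := combPerm_lt (a * b) (ρ * σ) ⟨x, h⟩
    have h2 := combPerm_lt b σ ⟨x, h⟩
    simp only at h1 h2
    rw [h1, Equiv.Perm.mul_apply, Equiv.Perm.mul_apply, h2, combPerm_lt]
  · obtain ⟨q, rfl⟩ := Nat.exists_eq_add_of_le h
    rw [Equiv.Perm.mul_apply, combPerm_add, combPerm_add, combPerm_add, Equiv.Perm.mul_apply]

/-- The permutation `ρ` maps the first `E` points to themselves. -/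
def Preserves (E : ℕ) (ρ : Equiv.Perm ℕ) : Prop := ∀ q, ρ q < E ↔ q < E

theorem Preserves.one (E : ℕ) : Preserves E 1 := fun _ => Iff.rfl

theorem Preserves.mul {E : ℕ} {ρ σ : Equiv.Perm ℕ} (hρ : Preserves E ρ) (hσ : Preserves E σ) :
    Preserves E (ρ * σ) := fun q => (hρ _).trans (hσ q)

theorem Preserves.swap {E a b : ℕ} (ha : a < E) (hb : b < E) : Preserves E (Equiv.swap a b) := by
  intro q
  rw [Equiv.swap_apply_def]
  split_ifs <;> omega

theorem Preserves.combPerm {n E : ℕ} {ρ : Equiv.Perm ℕ} (hρ : Preserves E ρ)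
    (a : Equiv.Perm (Fin n)) : Preserves (n + E) (combPerm n a ρ) := by
  intro x
  rcases lt_or_ge x n with h | h
  · have h1 := combPerm_lt a ρ ⟨x, h⟩
    simp only at h1
    rw [h1]
    omega
  · obtain ⟨q, rfl⟩ := Nat.exists_eq_add_of_le h
    rw [combPerm_add, Nat.add_lt_add_iff_left, Nat.add_lt_add_iff_left]
    exact hρ q

open Classical in
/-- The permutation that acts like `a` on the first `n` points and like `ρ` on the following `E`
points. -/
noncomputable def glue {n : ℕ} (E : ℕ) (a : SymGroup n) (ρ : (Equiv.Perm ℕ)ᵐᵒᵖ) :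
    SymGroup (n + E) :=
  if h : Preserves E ρ.unop then
    op (Fin.equivSubtype.symm.permCongr ((combPerm n a.unop ρ.unop).subtypePerm
      (p := fun x => x < n + E) (h.combPerm a.unop)))
  else 1

theorem glue_apply {n E : ℕ} (a : SymGroup n) {ρ : (Equiv.Perm ℕ)ᵐᵒᵖ} (h : Preserves E ρ.unop)
    (x : Fin (n + E)) : ((glue E a ρ).unop x : ℕ) = combPerm n a.unop ρ.unop x := by
  rw [glue, dif_pos h]
  simp only [unop_op, Equiv.permCongr_apply, Equiv.symm_symm]
  rfl

theorem glue_mul {n E : ℕ} (a b : SymGroup n) {ρ σ : (Equiv.Perm ℕ)ᵐᵒᵖ} (hρ : Preserves E ρ.unop)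
    (hσ : Preserves E σ.unop) : glue E (a * b) (ρ * σ) = glue E a ρ * glue E b σ := by
  refine unop_injective (Equiv.ext fun x => Fin.ext ?_)
  have h : Preserves E (ρ * σ).unop := hσ.mul hρ
  rw [glue_apply _ h, unop_mul, unop_mul, unop_mul, combPerm_mul, Equiv.Perm.mul_apply,
    Equiv.Perm.mul_apply, glue_apply _ hσ, glue_apply _ hρ]

theorem glue_one {n E : ℕ} : glue E (1 : SymGroup n) 1 = 1 := by
  have h := glue_mul (n := n) (ρ := 1) (σ := 1) 1 1 (Preserves.one E) (Preserves.one E)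
  rw [mul_one, mul_one] at h
  exact (left_eq_mul.1 h)

theorem glue_inj {n E : ℕ} {a b : SymGroup n} {ρ σ : (Equiv.Perm ℕ)ᵐᵒᵖ} (hρ : Preserves E ρ.unop)
    (hσ : Preserves E σ.unop) (h : glue E a ρ = glue E b σ) :
    a = b ∧ ∀ q < E, ρ.unop q = σ.unop q := by
  have key : ∀ x < n + E, combPerm n a.unop ρ.unop x = combPerm n b.unop σ.unop x := fun x hx => by
    rw [← glue_apply a hρ ⟨x, hx⟩, ← glue_apply b hσ ⟨x, hx⟩, h]
  refine ⟨unop_injective (Equiv.ext fun i => Fin.ext ?_), fun q hq => ?_⟩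
  · rw [← combPerm_lt _ ρ.unop, ← combPerm_lt _ σ.unop, key i (by omega)]
  · have := key (n + q) (by omega)
    rwa [combPerm_add, combPerm_add, Nat.add_left_cancel_iff] at this

theorem prod_glue {n E : ℕ} {α : Type} (f : α → SymGroup n) (ρ : α → (Equiv.Perm ℕ)ᵐᵒᵖ)
    {L : List α} (h : ∀ x ∈ L, Preserves E (ρ x).unop) :
    Preserves E (L.map ρ).prod.unop ∧
      (L.map fun x => glue E (f x) (ρ x)).prod = glue E (L.map f).prod (L.map ρ).prod := by
  induction L with
  | nil => exact ⟨Preserves.one E, glue_one.symm⟩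
  | cons x L ih =>
    obtain ⟨h1, h2⟩ := ih fun y hy => h y (List.mem_cons_of_mem _ hy)
    have hx := h x List.mem_cons_self
    simp only [List.map_cons, List.prod_cons, h2]
    exact ⟨h1.mul hx, (glue_mul _ _ hx h1).symm⟩

/-- `Nat.pair r c` lies below the square of `max r c + 1`, and `k + m + 3` exceeds every row and
column in question. Row `k + 1` is needed because times run up to `k` inclusive. -/
theorem pair_lt_auxPoints {k m r c : ℕ} (hr : r ≤ k + 1) (hc : c ≤ m + 2) :
    Nat.pair r c < auxPoints k m := by
  refine (Nat.pair_lt_max_add_one_sq r c).trans_le (Nat.pow_le_pow_left ?_ 2)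
  omega

theorem preserves_stepPerm {k m t x y : ℕ} (ht : t ≤ k) (hx : x ≤ m) (hy : y ≤ m) :
    Preserves (auxPoints k m) (stepPerm t x y) := by
  refine (Preserves.swap ?_ ?_).mul ((Preserves.swap ?_ ?_).mul (Preserves.swap ?_ ?_)) <;>
  exact pair_lt_auxPoints (by omega) (by omega)

theorem preserves_cyclePerm (k m : ℕ) : Preserves (auxPoints k m) (cyclePerm k) := by
  suffices h : ∀ s ≤ k, Preserves (auxPoints k m) (cyclePerm s) from h k le_rfl
  intro s hs
  induction s with
  | zero => exact Preserves.one _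
  | succ s ih =>
    exact (Preserves.swap (pair_lt_auxPoints (by omega) (by omega))
      (pair_lt_auxPoints (by omega) (by omega))).mul (ih (by omega))

/-! ### Chains of indices versus products of the new factors -/

/-- The triples for which there is an element in the list that is constructed. -/
def steps (g : ℕ → ℕ) (k m : ℕ) : List (ℕ × ℕ × ℕ) :=
  (List.range (k + 1)).flatMap fun t => (List.range m).flatMap fun j =>
    (List.range (m + 1)).flatMap fun i => if g i ≤ j + 1 then [(t, j, i)] else []

theorem mem_steps {g : ℕ → ℕ} {k m : ℕ} {e : ℕ × ℕ × ℕ} : e ∈ steps g k m ↔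
    e.1 ≤ k ∧ e.2.1 < m ∧ e.2.2 ≤ m ∧ g e.2.2 ≤ e.2.1 + 1 := by
  obtain ⟨t, j, i⟩ := e
  simp only [steps, List.mem_flatMap, List.mem_range, List.mem_ite_nil_right, List.mem_singleton,
    Prod.mk.injEq, Nat.lt_succ_iff]
  constructor
  · rintro ⟨t, ht, j, hj, i, hi, h, rfl, rfl, rfl⟩
    exact ⟨ht, hj, hi, h⟩
  · rintro ⟨ht, hj, hi, h⟩
    exact ⟨t, ht, j, hj, i, hi, h, rfl, rfl, rfl⟩

theorem preserves_auxPerm {g : ℕ → ℕ} {k m : ℕ} {e : ℕ × ℕ × ℕ} (he : e ∈ steps g k m) :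
    Preserves (auxPoints k m) (auxPerm k e) := by
  rw [mem_steps] at he
  refine preserves_stepPerm he.1 he.2.2.1 ?_
  split_ifs <;> omega

theorem map_sublist_flatMap {α β : Type} {f : α → β} {F : α → List β} :
    ∀ {l : List α}, (∀ x ∈ l, f x ∈ F x) → (l.map f).Sublist (l.flatMap F)
  | [], _ => .slnil
  | x :: l, h => by
    rw [List.map_cons, List.flatMap_cons, ← List.singleton_append]
    exact (List.singleton_sublist.2 (h x List.mem_cons_self)).append
      (map_sublist_flatMap fun y hy => h y (List.mem_cons_of_mem _ hy))

/-- The element that is constructed for a triple. -/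
noncomputable def stepElement {n : ℕ} (as : List (SymGroup n)) (k : ℕ) (e : ℕ × ℕ × ℕ) :
    SymGroup (n + auxPoints k as.length) :=
  glue _ (as.getD e.2.1 1) (op (auxPerm k e))

/-- The target that is constructed. -/
noncomputable def target {n : ℕ} (a : SymGroup n) (k m : ℕ) : SymGroup (n + auxPoints k m) :=
  glue _ a (op (cyclePerm k))

/-- At time `s` the factor is taken that uses the index `js[s]` and checks what its predecessor
wrote. Equal indices at different times give different entries of the list, so repetitions in `js`
do no harm. -/
theorem exists_sublist_of_chain {n : ℕ} {g : ℕ → ℕ} (hg : g 0 ≤ 1) {as : List (SymGroup n)}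
    {js : List ℕ} (hj : ∀ j ∈ js, j < as.length)
    (hc : js.IsChain fun i j => g (i + 1) ≤ j + 1) :
    ∃ L : List (SymGroup (n + auxPoints js.length as.length)),
        L.Sublist ((steps g js.length as.length).map (stepElement as js.length)) ∧
      L.length = js.length ∧
      L.prod = target (js.map fun j => as.getD j 1).prod js.length as.length := by
  let k := js.length
  -- The number recorded in row `s`: 0 at both ends, otherwise one plus the index used at time `s -
  -- 1`.
  let x : ℕ → ℕ := fun s => if s = 0 ∨ s = k then 0 else js.getD (s - 1) 0 + 1
  let f : ℕ → ℕ × ℕ × ℕ := fun s => (s, js.getD s 0, x s)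
  have hmem : ∀ s < k, f s ∈ steps g k as.length ∧ js.getD s 0 < as.length := by
    intro s hs
    have h1 : js.getD s 0 < as.length := by
      rw [List.getD_eq_getElem _ _ hs]
      exact hj _ (List.getElem_mem hs)
    refine ⟨mem_steps.2 ⟨hs.le, h1, ?_⟩, h1⟩
    simp only [f, x]
    rcases s with _ | s
    · simp; omega
    · have h3 : js.getD s 0 < as.length := by
        rw [List.getD_eq_getElem _ _ (by omega : s < js.length)]
        exact hj _ (List.getElem_mem _)
      rw [if_neg (by omega)]
      refine ⟨h3, ?_⟩
      have := List.isChain_iff_getElem.1 hc s hs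
      simp only [Nat.add_sub_cancel]
      rw [List.getD_eq_getElem _ _ (by omega : s < js.length), List.getD_eq_getElem _ _ hs]
      exact this
  refine ⟨((List.range k).map f).map (stepElement as k), ?_, by simp [k], ?_⟩
  · refine List.Sublist.map _ ?_
    change ((List.range k).map f).Sublist (steps g k as.length)
    -- The time `k` is never used and is split off; the remaining times contribute one triple each.
    rw [steps, List.range_succ (n := k), List.flatMap_append]
    refine (map_sublist_flatMap fun s hs => ?_).trans (List.sublist_append_left _ _)
    rw [List.mem_range] at hs
    obtain ⟨h1, h2⟩ := hmem s hs
    rw [mem_steps] at h1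
    simp only [List.mem_flatMap, List.mem_range, List.mem_ite_nil_right, List.mem_singleton]
    exact ⟨js.getD s 0, h2, x s, by have := h1.2.2.1; simp only [f] at this; omega, h1.2.2.2, rfl⟩
  · rw [List.map_map]
    have h1 := prod_glue (E := auxPoints k as.length) (fun s => as.getD (f s).2.1 1)
      (fun s => op (auxPerm k (f s))) (L := List.range k) fun s hs =>
        preserves_auxPerm (hmem s (List.mem_range.1 hs)).1
    have h2 : (List.range k).map (fun s => op (auxPerm k (f s))) =
        (List.range k).map fun s => op (stepPerm s (x s) (x (s + 1))) := by
      refine List.map_congr_left fun s _ => ?_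
      simp only [auxPerm, f, x]
      by_cases h : s + 1 = k <;> simp [h]
    have h3 : (List.range k).map (fun s => as.getD (f s).2.1 1) =
        js.map fun j => as.getD j 1 := by
      refine List.ext_getElem (by simp [k]) fun s h h' => ?_
      simp at h h'
      simp [f, h']
    have h4 := prod_stepPerm x (by simp [x]) k
    have hk : x k = 0 := by simp [x]
    -- Since the last step writes 0, the swap left over in row `k` is trivial and only the token
    -- cycle remains.
    rw [hk, zero_add, Equiv.swap_self] at h4
    rw [h2, h3, h4] at h1
    exact h1.2

/-- The two components of the product are compared separately. The old points give the value `a`;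
among the auxiliary points, the start of the token gives the times and column 1 of each row gives
the links. -/
theorem exists_chain_of_prod {n k : ℕ} {g : ℕ → ℕ} {a : SymGroup n} {as : List (SymGroup n)}
    {L : List (SymGroup (n + auxPoints k as.length))} (hk : L.length = k)
    (hL : ∀ b ∈ L, b ∈ (steps g k as.length).map (stepElement as k))
    (ha : L.prod = target a k as.length) :
    ∃ js : List ℕ, js.length = k ∧ (∀ j ∈ js, j < as.length) ∧
      (js.IsChain fun i j => g (i + 1) ≤ j + 1) ∧ (js.map fun j => as.getD j 1).prod = a := by
  obtain ⟨T, hT, rfl⟩ : ∃ T : List (ℕ × ℕ × ℕ), (∀ e ∈ T, e ∈ steps g k as.length) ∧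
      T.map (stepElement as k) = L := by
    clear hk ha
    induction L with
    | nil => exact ⟨[], by simp, rfl⟩
    | cons b L ih =>
      obtain ⟨T, hT, rfl⟩ := ih fun b hb => hL b (List.mem_cons_of_mem _ hb)
      obtain ⟨e, he, rfl⟩ := List.mem_map.1 (hL b List.mem_cons_self)
      exact ⟨e :: T, List.forall_mem_cons.2 ⟨he, hT⟩, rfl⟩
  rw [List.length_map] at hk
  obtain ⟨h1, h2⟩ := prod_glue (E := auxPoints k as.length) (fun e : ℕ × ℕ × ℕ => as.getD e.2.1 1)
    (fun e => op (auxPerm k e)) (L := T) fun e he => preserves_auxPerm (hT e he)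
  have h3 : glue _ (T.map fun e => as.getD e.2.1 1).prod (T.map fun e => op (auxPerm k e)).prod =
    glue (auxPoints k as.length) a (op (cyclePerm k)) := h2.symm.trans ha
  obtain ⟨h4, h5⟩ := glue_inj h1 (preserves_cyclePerm k as.length) h3
  have h6 : ∀ r c, r ≤ k → c ≤ 1 → auxAct k T (Nat.pair r c) = cyclePerm k (Nat.pair r c) :=
    fun r c hr hc => h5 _ (pair_lt_auxPoints (by omega) (by omega))
  have h7 : T.map Prod.fst = List.range' 0 T.length := by
    refine map_fst_eq_range' k T 0 ?_
    rw [h6 0 0 (by omega) (by omega), cyclePerm_pair_zero]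
    simp [hk]
  have h8 : Linked 0 T := by
    refine linked_of_auxAct T 0 0 (k := k) (by omega) h7 ?_ fun r hr hr' => ?_
    · rw [h6 0 (0 + 1) (by omega) (by omega), cyclePerm_pair_succ]
    · rw [h6 r 1 hr' (by omega), cyclePerm_pair_succ k r 0]
  refine ⟨T.map fun e => e.2.1, by simp [hk], fun j hj => ?_,
    h8.isChain fun e he => (mem_steps.1 (hT e he)).2.2.2, ?_⟩
  · obtain ⟨e, he, rfl⟩ := List.mem_map.1 hj
    exact (mem_steps.1 (hT e he)).2.1
  · rw [List.map_map]
    exact h4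

/-! ### Unique decoding of words -/

theorem binaryWord_injective : Function.Injective binaryWord := by
  intro x y h
  have hinj : Function.Injective fun b : Bool => bif b then Letter.one else Letter.zero := by
    intro a b; cases a <;> cases b <;> simp
  have hb := (List.map_injective_iff.2 hinj) h
  refine Nat.eq_of_testBit_eq fun i => ?_
  rw [Nat.testBit_eq_inth, Nat.testBit_eq_inth, hb]

theorem mem_binaryWord {x : ℕ} {y : Letter} (h : y ∈ binaryWord x) : y = .zero ∨ y = .one := by
  obtain ⟨b, -, rfl⟩ := List.mem_map.1 h
  cases b <;> simp

theorem lt_of_length_binaryWord_lt {x y : ℕ} (h : (binaryWord x).length < (binaryWord y).length) :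
    x < y := by
  by_contra hxy
  rw [binaryWord, binaryWord, List.length_map, List.length_map, Nat.size_eq_bits_len,
    Nat.size_eq_bits_len] at h
  exact absurd (Nat.size_le_size (not_lt.1 hxy)) (not_le.2 h)

theorem append_cons_inj {α : Type} {s : α} {a b x y : List α} (ha : s ∉ a) (hb : s ∉ b)
    (h : a ++ s :: x = b ++ s :: y) : a = b ∧ x = y := by
  induction a generalizing b with
  | nil =>
    rcases b with _ | ⟨c, b⟩
    · simpa using h
    · simp only [List.nil_append, List.cons_append, List.cons.injEq] at h
      exact absurd (h.1 ▸ List.mem_cons_self) hb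
  | cons d a ih =>
    rcases b with _ | ⟨c, b⟩
    · simp only [List.nil_append, List.cons_append, List.cons.injEq] at h
      exact absurd (h.1 ▸ List.mem_cons_self) ha
    · simp only [List.cons_append, List.cons.injEq] at h
      obtain ⟨rfl, rfl⟩ := ih (fun h => ha (List.mem_cons_of_mem _ h))
        (fun h => hb (List.mem_cons_of_mem _ h)) h.2
      exact ⟨by rw [h.1], rfl⟩

/-- The word for a list of numbers. -/
def entries (l : List ℕ) : List Letter := l.flatMap fun v => binaryWord v ++ [.comma]

theorem entries_cons (v : ℕ) (l : List ℕ) :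
    entries (v :: l) = binaryWord v ++ .comma :: entries l := by
  simp [entries]

theorem entries_append (l l' : List ℕ) : entries (l ++ l') = entries l ++ entries l' :=
  List.flatMap_append

theorem comma_notMem_binaryWord (x : ℕ) : Letter.comma ∉ binaryWord x := fun h => by
  simpa using mem_binaryWord h

theorem semicolon_notMem_entries (l : List ℕ) : Letter.semicolon ∉ entries l := by
  intro h
  obtain ⟨v, -, hv⟩ := List.mem_flatMap.1 h
  rcases List.mem_append.1 hv with h | h
  · simpa using mem_binaryWord h
  · simp at h

theorem entries_injective : Function.Injective entries := by
  intro l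
  induction l with
  | nil =>
    rintro (_ | ⟨v, l'⟩) h
    · rfl
    · simp [entries] at h
  | cons v l ih =>
    rintro (_ | ⟨v', l'⟩) h
    · simp [entries] at h
    · rw [entries_cons, entries_cons] at h
      obtain ⟨h1, h2⟩ := append_cons_inj (comma_notMem_binaryWord v) (comma_notMem_binaryWord v') h
      rw [binaryWord_injective h1, ih h2]

/-- If a list of numbers ends with the word of the list `X`, then it ends with `X`, unless the
number before that has swallowed the first one of `X`. -/
theorem entries_split {X : List ℕ} (hX : X ≠ []) : ∀ (Y : List ℕ) (f : List Letter),
    f ++ entries X = entries Y → (∃ Z, Y = Z ++ X ∧ f = entries Z) ∨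
      ∃ Z v' v X', X = v :: X' ∧ Y = Z ++ v' :: X' ∧ v < v'
  | [], f, h => by
    obtain ⟨v, X, rfl⟩ := List.exists_cons_of_ne_nil hX
    simp [entries] at h
  | y :: Y, f, h => by
    obtain ⟨v, X, rfl⟩ := List.exists_cons_of_ne_nil hX
    have h' : f ++ entries (v :: X) = (binaryWord y ++ [.comma]) ++ entries Y := by
      rw [h, entries_cons]; simp
    -- The cases differ by where `f` ends: within the numeral `y` and its comma, or after that
    -- comma. Only an end strictly inside a numeral lets that numeral absorb the first one of `X`.
    rcases List.append_eq_append_iff.1 h' with ⟨t, h1, h2⟩ | ⟨t, h1, h2⟩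
    · rcases List.eq_nil_or_concat t with rfl | ⟨t, c, rfl⟩
      · rw [List.append_nil] at h1
        rw [List.nil_append] at h2
        refine Or.inl ⟨[y], by rw [entries_injective h2]; rfl, ?_⟩
        rw [← h1, entries_cons]
        rfl
      · rw [List.concat_eq_append, ← List.append_assoc] at h1
        obtain ⟨h3, h4⟩ := List.append_inj' h1 rfl
        simp only [List.cons.injEq, and_true] at h4
        subst h4
        have ht : Letter.comma ∉ t := fun hmem =>
          comma_notMem_binaryWord y (h3 ▸ List.mem_append_right _ hmem)
        rw [entries_cons, List.concat_eq_append, List.append_assoc, List.singleton_append] at h2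
        obtain ⟨h5, h6⟩ := append_cons_inj (comma_notMem_binaryWord v) ht h2
        have h7 := entries_injective h6
        subst h7
        rcases f with _ | ⟨c, f⟩
        · rw [List.nil_append, ← h5] at h3
          exact Or.inl ⟨[], by rw [binaryWord_injective h3]; rfl, rfl⟩
        -- The numeral `y` is a nonempty word followed by the numeral of `v`. Being longer, it
        -- denotes a larger number.
        · refine Or.inr ⟨[], y, v, X, rfl, rfl, lt_of_length_binaryWord_lt ?_⟩
          rw [h3, ← h5]
          simp
    · rcases entries_split hX Y t h2.symm with ⟨Z, rfl, rfl⟩ | ⟨Z, v', v, X', h3, rfl, h4⟩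
      · refine Or.inl ⟨y :: Z, rfl, ?_⟩
        rw [h1, entries_cons]
        simp
      · exact Or.inr ⟨y :: Z, v', v, X', h3, rfl, h4⟩

/-- The values of a permutation. -/
def vals {n : ℕ} (π : SymGroup n) : List ℕ := (List.finRange n).map fun i => (π.unop i : ℕ) + 1

theorem permWord_eq {n : ℕ} (π : SymGroup n) : permWord π = entries (vals π) ++ [.semicolon] := by
  simp [permWord, entries, vals, List.flatMap_map]

theorem extWord_eq (n E : ℕ) (ρ : ℕ → ℕ) :
    extWord n E ρ = entries ((List.range E).map fun q => n + ρ q + 1) := by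
  rw [extWord, entries, List.flatMap_map]

theorem length_vals {n : ℕ} (π : SymGroup n) : (vals π).length = n := by simp [vals]

theorem nodup_vals {n : ℕ} (π : SymGroup n) : (vals π).Nodup := by
  refine (List.nodup_finRange n).map fun i j h => ?_
  simpa [Fin.val_inj] using h

theorem mem_vals {n : ℕ} {π : SymGroup n} {v : ℕ} (h : v ∈ vals π) : 1 ≤ v ∧ v ≤ n := by
  obtain ⟨i, -, rfl⟩ := List.mem_map.1 h
  exact ⟨by omega, (π.unop i).2⟩

theorem vals_injective {n : ℕ} : Function.Injective (vals : SymGroup n → List ℕ) := by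
  intro π σ h
  refine MulOpposite.unop_injective (Equiv.ext fun i => Fin.ext ?_)
  have := List.map_inj_left.1 h i (List.mem_finRange i)
  simpa using this

theorem exists_vals_eq {n : ℕ} {l : List ℕ} (hl : l.length = n) (hn : l.Nodup)
    (h : ∀ v ∈ l, 1 ≤ v ∧ v ≤ n) : ∃ π : SymGroup n, vals π = l := by
  subst hl
  let f : Fin l.length → Fin l.length := fun i => ⟨l[i] - 1, by
    have := h l[i] (List.getElem_mem _)
    omega⟩
  have hf : Function.Injective f := by
    intro i j hij
    have h1 := h l[i] (List.getElem_mem _)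
    have h2 := h l[j] (List.getElem_mem _)
    simp only [f, Fin.mk.injEq] at hij
    exact Fin.ext ((List.Nodup.getElem_inj_iff hn).1 (by
      simp only [Fin.getElem_fin] at *
      omega))
  refine ⟨MulOpposite.op (Equiv.ofBijective f (Finite.injective_iff_bijective.1 hf)), ?_⟩
  refine List.ext_getElem (by simp [vals]) fun i h1 h2 => ?_
  have := h l[i] (List.getElem_mem _)
  simp only [vals, MulOpposite.unop_op, List.getElem_map, Equiv.ofBijective_apply, f]
  simp
  omega

theorem vals_glue {n E : ℕ} (a : SymGroup n) {ρ : (Equiv.Perm ℕ)ᵐᵒᵖ} (h : Preserves E ρ.unop) :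
    vals (glue E a ρ) = vals a ++ (List.range E).map fun q => n + ρ.unop q + 1 := by
  refine List.ext_getElem (by simp [vals]) fun i h1 h2 => ?_
  simp only [vals, List.getElem_map, glue_apply a h, List.getElem_finRange]
  rcases lt_or_ge i n with hi | hi
  · rw [List.getElem_append_left (by simpa [vals] using hi)]
    have := combPerm_lt a.unop ρ.unop ⟨i, hi⟩
    simpa using this
  · obtain ⟨q, rfl⟩ := Nat.exists_eq_add_of_le hi
    rw [List.getElem_append_right (by simp)]
    have := combPerm_add a.unop ρ.unop q
    simpa using this

theorem entries_glue {n E : ℕ} (a : SymGroup n) {ρ : (Equiv.Perm ℕ)ᵐᵒᵖ} (h : Preserves E ρ.unop) :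
    entries (vals (glue E a ρ)) = entries (vals a) ++ extWord n E ρ.unop := by
  rw [vals_glue a h, entries_append, extWord_eq]

/-- Only the words of permutations are completed to words of permutations. -/
theorem exists_perm_of_append_extWord {n E : ℕ} {f : List Letter} {ρ : Equiv.Perm ℕ}
    (hE : 0 < E) (hρ : Preserves E ρ) {τ : SymGroup (n + E)}
    (h : f ++ extWord n E ρ = entries (vals τ)) : ∃ π : SymGroup n, f = entries (vals π) := by
  rw [extWord_eq] at h
  -- The extension already contains every value above `n`. So nothing that precedes it in the word
  -- of a permutation may exceed `n`.
  have hmem : ∀ w, n < w → w ≤ n + E → w ∈ (List.range E).map fun q => n + ρ q + 1 := by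
    intro w h1 h2
    refine List.mem_map.2 ⟨ρ.symm (w - n - 1), ?_, ?_⟩
    · rw [List.mem_range, ← hρ, Equiv.apply_symm_apply]
      omega
    · rw [Equiv.apply_symm_apply]
      omega
  rcases entries_split (by simpa using hE.ne') _ _ h with ⟨Z, h1, rfl⟩ | ⟨Z, v', v, X, h1, h2, h3⟩
  · have hn := nodup_vals τ
    rw [h1, List.nodup_append] at hn
    have hlen := congrArg List.length h1
    rw [length_vals, List.length_append, List.length_map, List.length_range] at hlen
    obtain ⟨π, rfl⟩ := exists_vals_eq (n := n) (by omega) hn.1 fun v hv => by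
      have h4 := mem_vals (π := τ) (h1 ▸ List.mem_append_left _ hv)
      refine ⟨h4.1, ?_⟩
      by_contra hlt
      exact hn.2.2 v hv v (hmem v (by omega) h4.2) rfl
    exact ⟨π, rfl⟩
  -- A merged number `v'` is larger than `v`, hence larger than `n`, so it also occurs in the
  -- extension. It is not `v`, so it occurs in the part after the merged entry, against injectivity
  -- of `τ`.
  · exfalso
    have hn := nodup_vals τ
    have h4 := mem_vals (π := τ) (v := v') (h2 ▸ by simp)
    have h5 : v ∈ (List.range E).map fun q => n + ρ q + 1 := h1 ▸ List.mem_cons_self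
    obtain ⟨q, -, hq⟩ := List.mem_map.1 h5
    have h6 := hmem v' (by omega) h4.2
    rw [h1] at h6
    rw [h2, List.nodup_append] at hn
    rcases List.mem_cons.1 h6 with rfl | h6
    · exact lt_irrefl _ h3
    · exact (List.nodup_cons.1 hn.2.1).1 h6

/-- Words terminated by semicolons. -/
def joinFields (fs : List (List Letter)) : List Letter := fs.flatMap fun f => f ++ [.semicolon]

theorem joinFields_cons (f : List Letter) (fs : List (List Letter)) :
    joinFields (f :: fs) = f ++ .semicolon :: joinFields fs := by
  simp [joinFields]

theorem instanceWord_eq (n : ℕ) (a : SymGroup n) (as : List (SymGroup n)) : instanceWord n a as =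
    joinFields (List.replicate n .one :: entries (vals a) :: as.map fun b => entries (vals b)) := by
  have h : (permWord : SymGroup n → List Letter) = fun b => entries (vals b) ++ [.semicolon] :=
    funext permWord_eq
  simp [instanceWord, joinFields, h, List.flatMap_map]

theorem joinFields_inj {fs fs' : List (List Letter)} (h : ∀ f ∈ fs, Letter.semicolon ∉ f)
    (h' : ∀ f ∈ fs', Letter.semicolon ∉ f) (he : joinFields fs = joinFields fs') : fs = fs' := by
  induction fs generalizing fs' with
  | nil =>
    rcases fs' with _ | ⟨f, fs'⟩
    · rfl
    · simp [joinFields] at he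
  | cons f fs ih =>
    rcases fs' with _ | ⟨f', fs'⟩
    · simp [joinFields] at he
    · rw [joinFields_cons, joinFields_cons] at he
      obtain ⟨rfl, h2⟩ := append_cons_inj (h _ List.mem_cons_self) (h' _ List.mem_cons_self) he
      rw [ih (fun f hf => h f (List.mem_cons_of_mem _ hf))
        (fun f hf => h' f (List.mem_cons_of_mem _ hf)) h2]

theorem field_append_semicolon {f : List Letter} (hf : Letter.semicolon ∉ f) (u : List Letter)
    (j : ℕ) : field (f ++ .semicolon :: u) j = if j = 0 then f else field u (j - 1) := by
  induction f with
  | nil => simp [field]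
  | cons x f ih =>
    rw [List.mem_cons, not_or] at hf
    rw [List.cons_append, field, if_neg (Ne.symm hf.1), ih hf.2]
    split_ifs <;> simp

theorem field_joinFields {fs : List (List Letter)} (h : ∀ f ∈ fs, Letter.semicolon ∉ f) (j : ℕ) :
    field (joinFields fs) j = fs.getD j [] := by
  induction fs generalizing j with
  | nil => simp [joinFields, field]
  | cons f fs ih =>
    rw [joinFields_cons, field_append_semicolon (h _ List.mem_cons_self),
      ih fun f hf => h f (List.mem_cons_of_mem _ hf)]
    rcases j with _ | j <;> simp

theorem semis_joinFields {fs : List (List Letter)} (h : ∀ f ∈ fs, Letter.semicolon ∉ f) :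
    semis (joinFields fs) = fs.length := by
  induction fs with
  | nil => rfl
  | cons f fs ih =>
    have := ih fun f hf => h f (List.mem_cons_of_mem _ hf)
    rw [semis] at this ⊢
    rw [joinFields_cons, List.count_append, List.count_eq_zero_of_not_mem (h _ List.mem_cons_self),
      List.count_cons_self, this, List.length_cons, zero_add]

theorem semicolon_notMem_field (u : List Letter) (j : ℕ) : Letter.semicolon ∉ field u j := by
  induction u generalizing j with
  | nil => simp [field]
  | cons x u ih =>
    rw [field]
    split_ifs with h1 h2 h2
    · simp
    · exact ih _
    · simpa [h2, Ne.symm h1] using ih 0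
    · simpa using ih j

theorem joinFields_field (u : List Letter) :
    joinFields ((List.range (semis u)).map (field u)) ++ field u (semis u) = u := by
  induction u with
  | nil => rfl
  | cons x u ih =>
    by_cases hx : x = .semicolon
    · subst hx
      have : semis (Letter.semicolon :: u) = semis u + 1 := by simp [semis]
      rw [this, List.range_succ_eq_map, List.map_cons, List.map_map, joinFields_cons]
      have h2 : field (Letter.semicolon :: u) ∘ Nat.succ = field u := by
        funext j; simp [field]
      have h3 : field (Letter.semicolon :: u) (semis u + 1) = field u (semis u) := by simp [field]
      rw [h2, h3, List.append_assoc, List.cons_append, ih]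
      simp [field]
    · have : semis (x :: u) = semis u := by simp [semis, hx]
      rw [this]
      rcases hs : semis u with _ | s
      · rw [hs] at ih
        simp only [List.range_zero, List.map_nil, joinFields, List.flatMap_nil,
          List.nil_append] at ih ⊢
        simp [field, hx, ih]
      · rw [hs] at ih
        rw [List.range_succ_eq_map, List.map_cons, List.map_map, joinFields_cons] at ih ⊢
        have h2 : field (x :: u) ∘ Nat.succ = field u ∘ Nat.succ := by
          funext j; simp [field, hx]
        have h3 : field (x :: u) (s + 1) = field u (s + 1) := by simp [field, hx]
        have h4 : field (x :: u) 0 = x :: field u 0 := by simp [field, hx]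
        rw [h2, h3, h4, List.cons_append, List.cons_append, ih]

/-! ### The reduction map on instances and on other words -/

open MulOpposite

theorem outWord_eq {g : ℕ → ℕ} {u : List Letter} {k m : ℕ} (h0 : field u 0 ≠ [])
    (hs : semis u = m + 2) (hu : field u (m + 2) = []) :
    outWord g u k = joinFields ((List.replicate (auxPoints k m) .one ++ field u 0) ::
      (field u 1 ++ extWord (field u 0).length (auxPoints k m) (cyclePerm k)) ::
      (steps g k m).map fun e =>
        field u (e.2.1 + 2) ++ extWord (field u 0).length (auxPoints k m) (auxPerm k e)) := by
  rw [outWord, if_neg (by simpa using h0), if_neg (by omega), if_pos (by rw [hs, hu]; rfl)]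
  simp only [hs, Nat.add_sub_cancel]
  rw [joinFields_cons, joinFields_cons, joinFields, List.flatMap_map, steps]
  simp only [List.flatMap_assoc, List.append_assoc, List.cons_append, List.nil_append]
  congr 6
  refine List.flatMap_congr fun t _ => List.flatMap_congr fun j _ => List.flatMap_congr fun i _ =>
      ?_
  split_ifs <;> simp [auxPerm, *]

theorem semicolon_notMem_instance {n : ℕ} (a : SymGroup n) (as : List (SymGroup n)) :
    ∀ f ∈ List.replicate n .one :: entries (vals a) :: as.map fun b => entries (vals b),
      Letter.semicolon ∉ f := by
  intro f hf
  simp only [List.mem_cons, List.mem_map] at hf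
  rcases hf with rfl | rfl | ⟨b, -, rfl⟩
  · simp [List.mem_replicate]
  · exact semicolon_notMem_entries _
  · exact semicolon_notMem_entries _

theorem outWord_instanceWord {g : ℕ → ℕ} {n k : ℕ} (hn : 1 ≤ n) (a : SymGroup n)
    (as : List (SymGroup n)) : outWord g (instanceWord n a as) k =
      instanceWord (n + auxPoints k as.length) (target a k as.length)
        ((steps g k as.length).map (stepElement as k)) := by
  have hf := field_joinFields (semicolon_notMem_instance a as)
  have hs := semis_joinFields (semicolon_notMem_instance a as)
  rw [← instanceWord_eq] at hf hs
  have h0 : field (instanceWord n a as) 0 = List.replicate n .one := by rw [hf]; rfl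
  have h1 : field (instanceWord n a as) 1 = entries (vals a) := by rw [hf]; rfl
  have h2 : ∀ j, j < as.length → field (instanceWord n a as) (j + 2) =
      entries (vals (as.getD j 1)) := by
    intro j hj
    rw [hf, List.getD_eq_getElem _ _ hj]
    simp [hj]
  rw [outWord_eq (m := as.length) (by rw [h0]; simp; omega) (by simpa using hs)
    (by rw [hf]; simp), h0, h1, List.length_replicate,
    instanceWord_eq (n + auxPoints k as.length), target,
    entries_glue a (ρ := op (cyclePerm k)) (preserves_cyclePerm k as.length),
        List.replicate_append_replicate,
    add_comm (auxPoints k as.length), List.map_map]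
  congr 3
  refine List.map_congr_left fun e he => ?_
  rw [Function.comp_apply, stepElement, entries_glue _ (ρ := op (auxPerm k e))
      (preserves_auxPerm he),
    h2 _ (mem_steps.1 he).2.1]
  rfl

/-- Correctness on inputs that are not instances rests on this. Rejected inputs give the empty word,
which is no instance word; in the other cases each input field can be recovered from the output and
is forced to be well formed. -/
theorem exists_instanceWord_of_outWord {g : ℕ → ℕ} (hg : g 0 ≤ 1) {u : List Letter} {k N : ℕ}
    {a' : SymGroup N} {as' : List (SymGroup N)} (h : outWord g u k = instanceWord N a' as') :
    ∃ (n : ℕ) (a : SymGroup n) (as : List (SymGroup n)), 1 ≤ n ∧ u = instanceWord n a as := by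
  have hne : outWord g u k ≠ [] := by rw [h, instanceWord]; simp
  have h0 : field u 0 ≠ [] := fun h0 => hne (by rw [outWord, if_pos (by simp [h0])])
  have hs : ¬ semis u ≤ 1 := fun hs => hne (by rw [outWord, if_neg (by simpa using h0), if_pos hs])
  have hu : field u (semis u) = [] := by
    by_contra hu
    exact hne (by rw [outWord, if_neg (by simpa using h0), if_neg hs, if_neg (by simpa using hu)])
  obtain ⟨m, hm⟩ : ∃ m, semis u = m + 2 := ⟨semis u - 2, by omega⟩
  have hE : 0 < auxPoints k m := by unfold auxPoints; positivity
  rw [hm] at hu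
  rw [outWord_eq h0 hm hu, instanceWord_eq] at h
  have hext : ∀ j ρ, Letter.semicolon ∉
      field u j ++ extWord (field u 0).length (auxPoints k m) ρ := by
    intro j ρ hmem
    rcases List.mem_append.1 hmem with h | h
    · exact semicolon_notMem_field _ _ h
    · rw [extWord_eq] at h
      exact semicolon_notMem_entries _ h
  have heq := joinFields_inj (fun f hf => by
    simp only [List.mem_cons, List.mem_map] at hf
    rcases hf with rfl | rfl | ⟨e, -, rfl⟩
    · simpa [List.mem_replicate] using semicolon_notMem_field u 0
    · exact hext _ _
    · exact hext _ _) (semicolon_notMem_instance a' as') h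
  rw [List.cons.injEq, List.cons.injEq] at heq
  obtain ⟨h1, h2, h3⟩ := heq
  have hN := congrArg List.length h1
  rw [List.length_append, List.length_replicate, List.length_replicate] at hN
  have h4 : field u 0 = List.replicate (field u 0).length .one := by
    refine List.eq_replicate_of_mem fun x hx => ?_
    have : x ∈ List.replicate N Letter.one := h1 ▸ List.mem_append_right _ hx
    exact List.eq_of_mem_replicate this
  obtain ⟨n, hn⟩ : ∃ n, (field u 0).length = n := ⟨_, rfl⟩
  rw [hn] at hN h2 h3 h4
  rw [add_comm] at hN
  subst hN
  obtain ⟨a, ha⟩ := exists_perm_of_append_extWord hE (preserves_cyclePerm k m) h2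
  have h5 : ∀ j : Fin m, ∃ b : SymGroup n, field u (j + 2) = entries (vals b) := by
    intro j
    -- Every field has to appear in the output, even for `k = 0`; this is why times range up to `k`
    -- inclusive. The bound `g 0 ≤ 1` admits every index at the start.
    have hmem : (0, (j : ℕ), 0) ∈ steps g k m :=
      mem_steps.2 ⟨Nat.zero_le _, j.2, Nat.zero_le _, hg.trans (by omega)⟩
    have h6 := List.mem_map_of_mem (f := fun e : ℕ × ℕ × ℕ =>
        field u (e.2.1 + 2) ++ extWord n (auxPoints k m) (auxPerm k e)) hmem
    rw [h3] at h6
    obtain ⟨b, -, hb⟩ := List.mem_map.1 h6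
    exact exists_perm_of_append_extWord hE (preserves_auxPerm hmem) hb.symm
  choose b hb using h5
  refine ⟨n, a, List.ofFn b, ?_, ?_⟩
  · rw [← hn]
    exact List.length_pos_iff.2 h0
  · conv_lhs => rw [← joinFields_field u]
    rw [hm, hu, List.append_nil, instanceWord_eq]
    congr 1
    refine List.ext_getElem (by simp) fun i h6 h7 => ?_
    rcases i with _ | _ | i
    · simpa using h4
    · simpa using ha
    · simp at h6
      simpa using hb ⟨i, by omega⟩

theorem instanceWord_inj {n n' : ℕ} {a : SymGroup n} {a' : SymGroup n'} {as : List (SymGroup n)}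
    {as' : List (SymGroup n')} (h : instanceWord n a as = instanceWord n' a' as') :
    (⟨n, a, as⟩ : Σ n, SymGroup n × List (SymGroup n)) = ⟨n', a', as'⟩ := by
  rw [instanceWord_eq, instanceWord_eq] at h
  have heq := joinFields_inj (semicolon_notMem_instance a as) (semicolon_notMem_instance a' as') h
  rw [List.cons.injEq, List.cons.injEq] at heq
  obtain ⟨h1, h2, h3⟩ := heq
  have hn := congrArg List.length h1
  rw [List.length_replicate, List.length_replicate] at hn
  subst hn
  rw [vals_injective (entries_injective h2), List.map_injective_iff.2 (fun x y hxy =>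
    vals_injective (entries_injective hxy)) h3]

/-! ### The three problems as chain products -/

/-- `a` is the product of `k` factors from the list `as`, whose indices form a chain with respect to
the relation `R`. -/
def IsChainProduct (R : ℕ → ℕ → Prop) {M : Type} [Monoid M] (a : M) (as : List M) (k : ℕ) : Prop :=
  ∃ js : List ℕ, js.length = k ∧ (∀ j ∈ js, j < as.length) ∧ js.IsChain R ∧
    (js.map fun j => as.getD j 1).prod = a

theorem isFactorization_iff {M : Type} [Monoid M] {a : M} {as : List M} {k : ℕ} :
    IsFactorization a as k ↔ ∃ L : List M, L.length = k ∧ (∀ b ∈ L, b ∈ as) ∧ L.prod = a := by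
  rw [IsFactorization, Set.mem_pow]
  constructor
  · rintro ⟨f, hf⟩
    exact ⟨_, by simp, fun b hb => by
      obtain ⟨i, rfl⟩ := (List.mem_ofFn' _ _).1 hb
      exact (f i).2, hf⟩
  · rintro ⟨L, rfl, hL, rfl⟩
    exact ⟨fun i => ⟨L[i], hL _ (List.getElem_mem _)⟩, by simp⟩

theorem isFactorization_iff_isChainProduct {M : Type} [Monoid M] {a : M} {as : List M} {k : ℕ} :
    IsFactorization a as k ↔ IsChainProduct (fun _ _ => True) a as k := by
  rw [isFactorization_iff]
  constructor
  · rintro ⟨L, rfl, hL, rfl⟩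
    have : ∃ js : List ℕ, (∀ j ∈ js, j < as.length) ∧ (js.map fun j => as.getD j 1) = L := by
      induction L with
      | nil => exact ⟨[], by simp, rfl⟩
      | cons b L ih =>
        obtain ⟨js, h1, rfl⟩ := ih fun b hb => hL b (List.mem_cons_of_mem _ hb)
        obtain ⟨j, hj, rfl⟩ := List.getElem_of_mem (hL b List.mem_cons_self)
        exact ⟨j :: js, List.forall_mem_cons.2 ⟨hj, h1⟩, by simp [hj]⟩
    obtain ⟨js, h1, rfl⟩ := this
    exact ⟨js, by simp, h1, List.isChain_iff_getElem.2 fun _ _ => trivial, rfl⟩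
  · rintro ⟨js, rfl, h, -, rfl⟩
    refine ⟨_, by simp, fun b hb => ?_, rfl⟩
    obtain ⟨j, hj, rfl⟩ := List.mem_map.1 hb
    rw [List.getD_eq_getElem _ _ (h j hj)]
    exact List.getElem_mem _

/-- The sorted list in which each index `i` occurs `x i` times. -/
def indexList {m : ℕ} (x : Fin m → ℕ) : List ℕ :=
  (List.finRange m).flatMap fun i => List.replicate (x i) (i : ℕ)

theorem length_indexList {m : ℕ} (x : Fin m → ℕ) : (indexList x).length = ∑ i, x i := by
  simp [indexList, List.length_flatMap, Fin.sum_univ_def]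

theorem lt_of_mem_indexList {m : ℕ} {x : Fin m → ℕ} {j : ℕ} (h : j ∈ indexList x) : j < m := by
  obtain ⟨i, -, hi⟩ := List.mem_flatMap.1 h
  rw [List.eq_of_mem_replicate hi]
  exact i.2

theorem prod_indexList {M : Type} [Monoid M] (as : List M) (x : Fin as.length → ℕ) :
    ((indexList x).map fun j => as.getD j 1).prod =
      (List.ofFn fun i => as.get i ^ x i).prod := by
  rw [indexList, List.map_flatMap, List.flatMap_def, List.prod_flatten, List.map_map,
    List.ofFn_eq_map]
  congr 1
  refine List.map_congr_left fun i _ => ?_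
  simp

theorem pairwise_indexList {m : ℕ} (x : Fin m → ℕ) : (indexList x).Pairwise (· ≤ ·) := by
  refine List.pairwise_flatMap.2 ⟨fun i _ => List.pairwise_replicate.2 (Or.inr le_rfl), ?_⟩
  refine (List.pairwise_lt_finRange m).imp fun {i j} hij a ha b hb => ?_
  rw [List.eq_of_mem_replicate ha, List.eq_of_mem_replicate hb]
  exact hij.le

theorem count_indexList {m : ℕ} (x : Fin m → ℕ) (i : Fin m) :
    (indexList x).count (i : ℕ) = x i := by
  simp only [indexList, List.count_flatMap, Function.comp_def, List.count_replicate, beq_iff_eq,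
    Fin.val_inj]
  rw [← Fin.sum_univ_def]
  simp

/-- Both lists are sorted and have the same multiplicities, and a sorted list is determined by
these. -/
theorem indexList_count {m : ℕ} {js : List ℕ} (hj : ∀ j ∈ js, j < m)
    (h : js.Pairwise (· ≤ ·)) : indexList (fun i : Fin m => js.count (i : ℕ)) = js := by
  refine List.Perm.eq_of_pairwise (fun a b _ _ => le_antisymm) (pairwise_indexList _) h ?_
  refine List.perm_iff_count.2 fun j => ?_
  by_cases hm : j < m
  · exact count_indexList _ ⟨j, hm⟩
  · rw [List.count_eq_zero_of_not_mem fun h => hm (lt_of_mem_indexList h),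
      List.count_eq_zero_of_not_mem fun h => hm (hj j h)]

theorem isKnapsack_iff_isChainProduct {M : Type} [Monoid M] {a : M} {as : List M} {k : ℕ} :
    IsKnapsack a as k ↔ IsChainProduct (· ≤ ·) a as k := by
  constructor
  · rintro ⟨x, rfl, rfl⟩
    exact ⟨indexList x, length_indexList x, fun j => lt_of_mem_indexList,
      List.isChain_iff_pairwise.2 (pairwise_indexList x), prod_indexList as x⟩
  · rintro ⟨js, rfl, hj, hc, rfl⟩
    have h := indexList_count hj (List.isChain_iff_pairwise.1 hc)
    exact ⟨fun i => js.count (i : ℕ), by rw [← length_indexList, h], by rw [← prod_indexList, h]⟩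

/-- Exponents at most 1 say that the sorted list of indices has no repetitions, that is, it
increases strictly. -/
theorem isSubsetSum_iff_isChainProduct {M : Type} [Monoid M] {a : M} {as : List M} {k : ℕ} :
    IsSubsetSum a as k ↔ IsChainProduct (· < ·) a as k := by
  constructor
  · rintro ⟨x, hx, rfl, rfl⟩
    have hn : (indexList x).Nodup := List.nodup_iff_count_le_one.2 fun j => by
      by_cases hm : j < as.length
      · have := hx ⟨j, hm⟩
        rw [← count_indexList x] at this
        simp only at this
        omega
      · rw [List.count_eq_zero_of_not_mem fun h => hm (lt_of_mem_indexList h)]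
        exact zero_le_one
    exact ⟨indexList x, length_indexList x, fun j => lt_of_mem_indexList,
      List.isChain_iff_pairwise.2 (((pairwise_indexList x).and hn).imp fun h =>
        lt_of_le_of_ne h.1 h.2), prod_indexList as x⟩
  · rintro ⟨js, rfl, hj, hc, rfl⟩
    have hp := List.isChain_iff_pairwise.1 hc
    have h := indexList_count hj (hp.imp le_of_lt)
    have hn : js.Nodup := hp.imp ne_of_lt
    refine ⟨fun i => js.count (i : ℕ), fun i => ?_, by rw [← length_indexList, h],
      by rw [← prod_indexList, h]⟩
    have := List.nodup_iff_count_le_one.1 hn i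
    show js.count (i : ℕ) = 0 ∨ js.count (i : ℕ) = 1
    omega

/-- The exponents are the indicator function of the positions that are kept. -/
theorem IsSubsetSum.of_sublist {M : Type} [Monoid M] {L as : List M} (h : L.Sublist as) :
    IsSubsetSum L.prod as L.length := by
  induction h with
  | slnil => exact ⟨fun _ => 0, by simp, by simp, by simp⟩
  | @cons L as b _ ih =>
    obtain ⟨x, h0, h1, h2⟩ := ih
    refine ⟨Fin.cons 0 x, Fin.cases (by simp) (by simpa using h0), ?_, ?_⟩
    · exact (Fin.sum_univ_succ _).trans (by simpa using h1)
    · rw [h2]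
      simp
  | @cons_cons L as b _ ih =>
    obtain ⟨x, h0, h1, h2⟩ := ih
    refine ⟨Fin.cons 1 x, Fin.cases (by simp) (by simpa using h0), ?_, ?_⟩
    · exact (Fin.sum_univ_succ _).trans (by simp [h1, add_comm])
    · rw [List.prod_cons, h2]
      simp

theorem IsSubsetSum.isKnapsack {M : Type} [Monoid M] {a : M} {as : List M} {k : ℕ}
    (h : IsSubsetSum a as k) : IsKnapsack a as k := by
  obtain ⟨x, -, h⟩ := h
  exact ⟨x, h⟩

theorem IsChainProduct.mono {R S : ℕ → ℕ → Prop} {M : Type} [Monoid M] {a : M} {as : List M}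
    {k : ℕ} (hRS : ∀ i j, R i j → S i j) (h : IsChainProduct R a as k) :
    IsChainProduct S a as k := by
  obtain ⟨js, h1, h2, h3, h4⟩ := h
  exact ⟨js, h1, h2, h3.imp hRS, h4⟩

theorem IsKnapsack.isFactorization {M : Type} [Monoid M] {a : M} {as : List M} {k : ℕ}
    (h : IsKnapsack a as k) : IsFactorization a as k :=
  isFactorization_iff_isChainProduct.2
    ((isKnapsack_iff_isChainProduct.1 h).mono fun _ _ _ => trivial)

/-! ### The reductions -/

theorem computableInFptTime_outWord {g : ℕ → ℕ} (hg : ∀ d i,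
    StackProg.EmitsNat d fun _ env => g (env i)) :
    ComputableInFptTime fun x : List Letter × ℕ => (outWord g x.1 x.2, x.2) :=
  StackProg.computableInFptTime_of_emits (StackProg.emits_outWord hg)

/-- Products of chains reduce to every problem between subset sum and factorization. -/
theorem fptReducible_of_isChainProduct {Q Q' : ∀ {M : Type} [Monoid M], M → List M → ℕ → Prop}
    {g : ℕ → ℕ} (hg : g 0 ≤ 1)
    (hc : ComputableInFptTime fun x : List Letter × ℕ => (outWord g x.1 x.2, x.2))
    (hQ : ∀ {M : Type} [Monoid M] {a : M} {as : List M} {k : ℕ},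
      Q a as k ↔ IsChainProduct (fun i j => g (i + 1) ≤ j + 1) a as k)
    (hQ' : ∀ {M : Type} [Monoid M] {a : M} {as : List M} {k : ℕ},
      IsSubsetSum a as k → Q' a as k)
    (hF : ∀ {M : Type} [Monoid M] {a : M} {as : List M} {k : ℕ},
      Q' a as k → IsFactorization a as k) :
    FptReducible (symmetricGroupProblem @Q) (symmetricGroupProblem @Q') := by
  refine ⟨_, ⟨outWord g, id, fun _ _ => rfl⟩, hc, fun u k => ⟨?_, ?_⟩⟩
  · rintro ⟨n, a, as, hn, hu, hq⟩
    obtain ⟨js, rfl, hj, hc, rfl⟩ := hQ.1 hq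
    obtain ⟨L, h1, h2, h3⟩ := exists_sublist_of_chain hg hj hc
    refine ⟨_, _, _, hn.trans (Nat.le_add_right _ _),
      (congrArg (fun v => outWord g v js.length) hu).trans (outWord_instanceWord hn _ _), hQ' ?_⟩
    rw [← h3]
    have := IsSubsetSum.of_sublist h1
    rwa [h2] at this
  · rintro ⟨N, a', as', -, hu, hq⟩
    obtain ⟨n, a, as, hn, rfl⟩ := exists_instanceWord_of_outWord hg hu
    refine ⟨n, a, as, hn, rfl, hQ.2 ?_⟩
    -- An instance word determines its instance, so `N`, `a'` and `as'` are the degree, target and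
    -- list that were constructed.
    have h := instanceWord_inj ((outWord_instanceWord hn a as).symm.trans hu)
    cases h
    obtain ⟨L, h1, h2, h3⟩ := isFactorization_iff.1 (hF hq)
    exact exists_chain_of_prod h1 h2 h3

theorem fptReducible_pFSym {Q' : ∀ {M : Type} [Monoid M], M → List M → ℕ → Prop}
    (hQ' : ∀ {M : Type} [Monoid M] {a : M} {as : List M} {k : ℕ},
      IsSubsetSum a as k → Q' a as k)
    (hF : ∀ {M : Type} [Monoid M] {a : M} {as : List M} {k : ℕ},
      Q' a as k → IsFactorization a as k) : FptReducible pFSym (symmetricGroupProblem @Q') :=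
  fptReducible_of_isChainProduct (g := fun _ => 0) zero_le_one
    (computableInFptTime_outWord fun _ _ => StackProg.EmitsNat.const 0)
    (by simp [isFactorization_iff_isChainProduct]) hQ' hF

theorem fptReducible_pKSSym {Q' : ∀ {M : Type} [Monoid M], M → List M → ℕ → Prop}
    (hQ' : ∀ {M : Type} [Monoid M] {a : M} {as : List M} {k : ℕ},
      IsSubsetSum a as k → Q' a as k)
    (hF : ∀ {M : Type} [Monoid M] {a : M} {as : List M} {k : ℕ},
      Q' a as k → IsFactorization a as k) : FptReducible pKSSym (symmetricGroupProblem @Q') :=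
  fptReducible_of_isChainProduct (g := id) zero_le_one
    (computableInFptTime_outWord fun _ _ => StackProg.EmitsNat.var)
    (by simp [isKnapsack_iff_isChainProduct]) hQ' hF

theorem fptReducible_pSSSSym {Q' : ∀ {M : Type} [Monoid M], M → List M → ℕ → Prop}
    (hQ' : ∀ {M : Type} [Monoid M] {a : M} {as : List M} {k : ℕ},
      IsSubsetSum a as k → Q' a as k)
    (hF : ∀ {M : Type} [Monoid M] {a : M} {as : List M} {k : ℕ},
      Q' a as k → IsFactorization a as k) : FptReducible pSSSSym (symmetricGroupProblem @Q') :=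
  fptReducible_of_isChainProduct (g := fun i => i + 1) le_rfl
    (computableInFptTime_outWord fun _ _ => StackProg.EmitsNat.var.add (.const 1))
    (by simp [isSubsetSum_iff_isChainProduct]) hQ' hF

theorem theorem4p3 :
    FptEquivalent pFSym pKSSym ∧ FptEquivalent pKSSym pSSSSym ∧ FptEquivalent pFSym pSSSSym :=
  ⟨⟨fptReducible_pFSym IsSubsetSum.isKnapsack IsKnapsack.isFactorization,
    fptReducible_pKSSym (fun h => h.isKnapsack.isFactorization) id⟩,
    ⟨fptReducible_pKSSym id fun h => h.isKnapsack.isFactorization,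
    fptReducible_pSSSSym IsSubsetSum.isKnapsack IsKnapsack.isFactorization⟩,
    fptReducible_pFSym id fun h => h.isKnapsack.isFactorization,
    fptReducible_pSSSSym (fun h => h.isKnapsack.isFactorization) id⟩
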